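/- **Setting.** Let $(\mathcal D,\wedge,S^0)$ be a pointed (closed) symmetric monoidal model category, and write $[-,-]$ for the morphism sets of $\mathrm{Ho}(\mathcal D)$. Let $T$ be a cofibrant object of $\mathcal D$ such that $-\wedge T$ preserves weak equivalences and such that $T$ is equipped with the structure of a cogroup object of $\mathrm{Ho}(\mathcal D)$. Let $T$ have a *sign*, i.e. an automorphism $(-1)_T$ of $T$ in $\mathrm{Ho}(\mathcal D)$ with $(-1)_T^2=\mathrm{id}$ such that, with $|\tau|_T:=\mathrm{id}_T$ for an even permutation $\tau$ and $|\tau|_T:=(-1)_T$ for an odd one, * for all $n\ge 1$ and $\tau\in\Sigma_n$ the permutation of the factors of $T^{n}=T\wedge\dots\wedge T$ by $\tau$ equals $|\tau|_T\wedge T^{n-1}$ in $\mathrm{Ho}(\mathcal D)$; * $(-1)_T\wedge T=T\wedge(-1)_T$ on $T^2$ in $\mathrm{Ho}(\mathcal D)$. Let $\mathcal B$ be a class of cofibrant objects of $\mathcal D$. A *symmetric $T$-spectrum* $X$ consists of objects $X_n$ ($n\ge0$) of $\mathcal D$ with left $\Sigma_n$-actions and maps $\sigma\colon X_n\wedge T\to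 X_{n+1}$ such that all iterates $\sigma^p\colon X_n\wedge T^p\to X_{n+p}$ are $\Sigma_n\times\Sigma_p$-equivariant. For $q\in\mathbb Z$ and $V\in\mathcal B$ put $$\pi_q^V(X)=\operatorname{colim}_{m\ge0,\;q+m\ge1}\,[V\wedge T^{q+m},X_m],$$ with transition maps $[V\wedge T^{q+m},X_m]\to[V\wedge T^{q+m+1},X_{m+1}]$, $x\mapsto\sigma\circ(x\wedge T)$; the group structures come from the cogroup structure of the first factor $T$. Let $\mathcal M$ be the monoid of injective self-maps of $\mathbb N=\{1,2,\dots\}$. It acts on the set $\pi_q^V(X)$ as follows. If $f\in\mathcal M$ and $x\in[V\wedge T^{q+m},X_m]$, choose $n\ge m$ and $\gamma\in\Sigma_n$ with $\gamma(i)=f(i)$ for $1\le i\le m$; then $f\cdot[x]$ is the class of $$\gamma\circ\sigma^{n-m}\circ(x\wedge T^{n-m})\circ(V\wedge|\gamma|_T\wedge T^{q+n-1})\in[V\wedge T^{q+n},X_n].$$ (This is well defined.) The spectrum $X$ is called *semistable* if $\mathcal M$ acts trivially on $\pi_q^V(X)$ for all $q\in\mathbb Z$ and $V\in\mathcal B$.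 **Proposition.** A symmetric $T$-spectrum $X$ is semistable if one of the following conditions holds. 1. For all $q\in\mathbb Z$ and $V\in\mathcal B$ there is an $l\ge0$ with $q+l\ge1$ such that the canonical map $[V\wedge T^{q+l},X_l]\to\pi_q^V(X)$ is surjective. 2. For all $l\ge 0$, every even permutation in $\Sigma_l$ acts on $X_l$ as the identity in $\mathrm{Ho}(\mathcal D)$. 3. For all $q\in\mathbb Z$ and $V\in\mathcal B$, the group $\pi_q^V(X)$ is a finitely generated abelian group. Moreover, condition 1 holds if the stable homotopy groups stabilize, i.e. if for all $q\in\mathbb Z$ and $V\in\mathcal B$ the map $[V\wedge T^{q+n},X_n]\to[V\wedge T^{q+n+1},X_{n+1}]$ is an isomorphism for all sufficiently large $n$. -/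

import Mathlib

open CategoryTheory MonoidalCategory Limits HomotopicalAlgebra

universe v u

namespace SymSp
noncomputable section
set_option linter.unusedSectionVars false

section

variable {D : Type u} [Category.{v} D] [ModelCategory D] [MonoidalCategory D]

/-- A monoidal model category: a closed (symmetric) monoidal category with a model structure which
satisfies the pushout product axiom and the unit axiom. -/
class MonoidalModelCategory (D : Type u) [Category.{v} D] [ModelCategory D]
    [MonoidalCategory D] : Prop where
  cofibration_pushoutProduct {A B X Y : D} (f : A ⟶ B) (g : X ⟶ Y)
    [Cofibration f] [Cofibration g] (sq : (curriedTensor D).PushoutObjObj f g) :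
    Cofibration sq.ι
  weakEquivalence_pushoutProduct {A B X Y : D} (f : A ⟶ B) (g : X ⟶ Y)
    [Cofibration f] [Cofibration g] (h : WeakEquivalence f ∨ WeakEquivalence g)
    (sq : (curriedTensor D).PushoutObjObj f g) : WeakEquivalence sq.ι
  unit_left {Q : D} (p : Q ⟶ 𝟙_ D) [IsCofibrant Q] [WeakEquivalence p]
    (X : D) [IsCofibrant X] : WeakEquivalence (p ▷ X)
  unit_right {Q : D} (p : Q ⟶ 𝟙_ D) [IsCofibrant Q] [WeakEquivalence p]
    (X : D) [IsCofibrant X] : WeakEquivalence (X ◁ p)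

/-- The functor `- ∧ T` preserves weak equivalences. -/
class SmashPreservesWeakEquivalences (T : D) : Prop where
  whiskerRight {X Y : D} (f : X ⟶ Y) [WeakEquivalence f] : WeakEquivalence (f ▷ T)

section quillen
variable {F G : D ⥤ D}

/-- Left Quillen endofunctors of a model category. -/
structure IsLeftQuillen (F : D ⥤ D) : Prop where
  isLeftAdjoint : F.IsLeftAdjoint
  cofibration {X Y : D} (f : X ⟶ Y) [Cofibration f] : Cofibration (F.map f)
  weakEquivalence {X Y : D} (f : X ⟶ Y) [Cofibration f] [WeakEquivalence f] :
    WeakEquivalence (F.map f)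

lemma IsLeftQuillen.isCofibrant (hF : IsLeftQuillen F) (A : D) [IsCofibrant A] : IsCofibrant (F.obj A) := by
  have := hF.isLeftAdjoint
  have := hF.cofibration (initial.to A)
  rw [isCofibrant_iff_of_isInitial (F.map (initial.to A))
    (IsInitial.isInitialObj F _ initialIsInitial)]
  infer_instance

lemma IsLeftQuillen.weakEquivalence_map (hF : IsLeftQuillen F) {A B : D} [IsCofibrant A] [IsCofibrant B] (f : A ⟶ B)
    [WeakEquivalence f] : WeakEquivalence (F.map f) := by
  obtain ⟨h⟩ := (inferInstance : Nonempty (CofibrantBrownFactorization f))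
  have h1 : WeakEquivalence (F.map h.i) := hF.weakEquivalence h.i
  have h2 : WeakEquivalence (F.map h.s) := hF.weakEquivalence h.s
  have h3 : WeakEquivalence (F.map h.p) :=
    weakEquivalence_of_precomp_of_fac (f := F.map h.s) (fg := 𝟙 _)
      (by rw [← F.map_comp, h.s_p, F.map_id])
  rw [← h.fac, F.map_comp]
  infer_instance

lemma IsLeftQuillen.inverts (hF : IsLeftQuillen F) :
    (weakEquivalences (CofibrantObject D)).IsInvertedBy
      (CofibrantObject.ι ⋙ F ⋙ (weakEquivalences D).Q) := by
  intro X Y f hf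
  have : WeakEquivalence f.hom := ⟨hf⟩
  have := hF.weakEquivalence_map f.hom
  exact Localization.inverts (weakEquivalences D).Q (weakEquivalences D) _
    (mem_weakEquivalences (F.map f.hom))

/-- The left derived functor of a left Quillen functor: the functor induced on the localization
by its restriction to cofibrant objects. -/
def leftDerived (hF : IsLeftQuillen F) : (weakEquivalences D).Localization ⥤ (weakEquivalences D).Localization :=
  Localization.lift _ hF.inverts (CofibrantObject.ι ⋙ (weakEquivalences D).Q)

/-- On cofibrant objects, the left derived functor of `F` is given by `F`. -/
def leftDerivedIso (hF : IsLeftQuillen F) : (CofibrantObject.ι ⋙ (weakEquivalences D).Q) ⋙ leftDerived hF ≅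
    CofibrantObject.ι ⋙ F ⋙ (weakEquivalences D).Q :=
  Localization.fac _ hF.inverts _

end quillen

section
variable [SymmetricCategory D] [MonoidalClosed D] [MonoidalModelCategory D]

lemma isLeftQuillen_tensorLeft (V : D) [IsCofibrant V] : IsLeftQuillen (tensorLeft V) where
  isLeftAdjoint := inferInstance
  cofibration {X Y} f _ := by
    have : PreservesColimitsOfShape (Discrete PEmpty.{1}) ((curriedTensor D).flip.obj X) :=
      inferInstanceAs (PreservesColimitsOfShape _ (tensorRight X))
    have : PreservesColimitsOfShape (Discrete PEmpty.{1}) ((curriedTensor D).flip.obj Y) :=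
      inferInstanceAs (PreservesColimitsOfShape _ (tensorRight Y))
    exact MonoidalModelCategory.cofibration_pushoutProduct (initial.to V) f
      (Functor.PushoutObjObj.ofIsInitialLeft _ _ _ initialIsInitial)
  weakEquivalence {X Y} f _ _ := by
    have : PreservesColimitsOfShape (Discrete PEmpty.{1}) ((curriedTensor D).flip.obj X) :=
      inferInstanceAs (PreservesColimitsOfShape _ (tensorRight X))
    have : PreservesColimitsOfShape (Discrete PEmpty.{1}) ((curriedTensor D).flip.obj Y) :=
      inferInstanceAs (PreservesColimitsOfShape _ (tensorRight Y))
    exact MonoidalModelCategory.weakEquivalence_pushoutProduct (initial.to V) f (.inr inferInstance)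
      (Functor.PushoutObjObj.ofIsInitialLeft _ _ _ initialIsInitial)

lemma isLeftQuillen_tensorRight (V : D) [IsCofibrant V] : IsLeftQuillen (tensorRight V) where
  isLeftAdjoint := inferInstance
  cofibration {X Y} f _ := by
    have : PreservesColimitsOfShape (Discrete PEmpty.{1}) ((curriedTensor D).obj X) :=
      inferInstanceAs (PreservesColimitsOfShape _ (tensorLeft X))
    have : PreservesColimitsOfShape (Discrete PEmpty.{1}) ((curriedTensor D).obj Y) :=
      inferInstanceAs (PreservesColimitsOfShape _ (tensorLeft Y))
    exact MonoidalModelCategory.cofibration_pushoutProduct f (initial.to V)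
      (Functor.PushoutObjObj.ofIsInitialRight _ _ _ initialIsInitial)
  weakEquivalence {X Y} f _ _ := by
    have : PreservesColimitsOfShape (Discrete PEmpty.{1}) ((curriedTensor D).obj X) :=
      inferInstanceAs (PreservesColimitsOfShape _ (tensorLeft X))
    have : PreservesColimitsOfShape (Discrete PEmpty.{1}) ((curriedTensor D).obj Y) :=
      inferInstanceAs (PreservesColimitsOfShape _ (tensorLeft Y))
    exact MonoidalModelCategory.weakEquivalence_pushoutProduct f (initial.to V) (.inl inferInstance)
      (Functor.PushoutObjObj.ofIsInitialRight _ _ _ initialIsInitial)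
end

lemma exists_fibrant_iso (Y : (weakEquivalences D).Localization) :
    ∃ (Z : D) (_ : IsFibrant Z), Nonempty ((weakEquivalences D).Q.obj Z ≅ Y) := by
  have := Localization.essSurj (weakEquivalences D).Q (weakEquivalences D)
  have h := MorphismProperty.factorizationData (trivialCofibrations D) (fibrations D)
    (terminal.from ((weakEquivalences D).Q.objPreimage Y))
  have hi : WeakEquivalence h.i := inferInstance
  refine ⟨h.Z, ?_, ⟨(Localization.isoOfHom (weakEquivalences D).Q (weakEquivalences D) h.i
    (mem_weakEquivalences _)).symm ≪≫ (weakEquivalences D).Q.objObjPreimageIso Y⟩⟩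
  rw [isFibrant_iff, Subsingleton.elim (terminal.from h.Z) h.p]
  infer_instance

lemma IsLeftQuillen.fibration_map {F G : D ⥤ D} (hF : IsLeftQuillen F) (adj : F ⊣ G)
    {X Y : D} (p : X ⟶ Y) [Fibration p] : Fibration (G.map p) := by
  rw [fibration_iff, ← MorphismProperty.rlp_eq_of_wfs (trivialCofibrations D) (fibrations D)]
  intro A B i hi
  obtain ⟨_, _⟩ := (mem_trivialCofibrations_iff i).mp hi
  rw [← adj.hasLiftingProperty_iff]
  have := hF.cofibration i
  have := hF.weakEquivalence i
  infer_instance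

lemma IsLeftQuillen.weakEquivalence_map_right {F G : D ⥤ D} (hF : IsLeftQuillen F) (adj : F ⊣ G)
    {X Y : D} (p : X ⟶ Y) [Fibration p] [WeakEquivalence p] : WeakEquivalence (G.map p) := by
  suffices trivialFibrations D (G.map p) from ((mem_trivialFibrations_iff _).mp this).2
  rw [← MorphismProperty.rlp_eq_of_wfs (cofibrations D) (trivialFibrations D)]
  intro A B i hi
  rw [← cofibration_iff] at hi
  rw [← adj.hasLiftingProperty_iff]
  have := hF.cofibration i
  infer_instance

/-- The universal property which shows that the left derived functor has a right adjoint. -/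
lemma leftQuillen_universal {F G : D ⥤ D} (hF : IsLeftQuillen F) (adj : F ⊣ G)
    {F' : (weakEquivalences D).Localization ⥤ (weakEquivalences D).Localization}
    (e : (CofibrantObject.ι ⋙ (weakEquivalences D).Q) ⋙ F' ≅
      CofibrantObject.ι ⋙ F ⋙ (weakEquivalences D).Q)
    (Y : D) [IsFibrant Y] (C : D) [IsCofibrant C] (p : C ⟶ G.obj Y) [Fibration p]
    [WeakEquivalence p] (A : D) [IsCofibrant A]
    (f : F'.obj ((weakEquivalences D).Q.obj A) ⟶ (weakEquivalences D).Q.obj Y) :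
    ∃! u : (weakEquivalences D).Q.obj A ⟶ (weakEquivalences D).Q.obj C,
      F'.map u ≫ e.hom.app (.mk C) ≫ (weakEquivalences D).Q.map ((adj.homEquiv C Y).symm p) = f := by
  have := hF.isLeftAdjoint
  have hFA := hF.isCofibrant A
  have hGY : IsFibrant (G.obj Y) := by
    have := adj.isRightAdjoint
    have := hF.fibration_map adj (terminal.from Y)
    rwa [← isFibrant_iff_of_isTerminal (G.map (terminal.from Y))
      (IsTerminal.isTerminalObj G _ terminalIsTerminal)] at this
  have hC : IsFibrant C := isFibrant_of_fibration p
  have nat (w : A ⟶ C) : F'.map ((weakEquivalences D).Q.map w) ≫ e.hom.app (.mk C) =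
      e.hom.app (.mk A) ≫ (weakEquivalences D).Q.map (F.map w) :=
    e.hom.naturality (CofibrantObject.homMk w)
  obtain ⟨g, hg⟩ := map_surjective_of_isLocalization (weakEquivalences D).Q _ _
    (e.inv.app (.mk A) ≫ f : (weakEquivalences D).Q.obj (F.obj A) ⟶ _)
  have sq : CommSq (initial.to C) (initial.to A) p (adj.homEquiv _ _ g) := ⟨by simp⟩
  refine ⟨(weakEquivalences D).Q.map sq.lift, ?_, ?_⟩
  · have h1 : F.map sq.lift ≫ (adj.homEquiv C Y).symm p = g := by
      rw [← Adjunction.homEquiv_naturality_left_symm, sq.fac_right, Equiv.symm_apply_apply]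
    dsimp only
    rw [reassoc_of% nat, ← Functor.map_comp, h1, hg]
    exact Iso.hom_inv_id_app_assoc e _ _
  · intro v hv
    obtain ⟨v, rfl⟩ := map_surjective_of_isLocalization (weakEquivalences D).Q _ _ v
    rw [reassoc_of% nat, ← Functor.map_comp] at hv
    have h2 : (weakEquivalences D).Q.map (F.map v ≫ (adj.homEquiv C Y).symm p) =
        (weakEquivalences D).Q.map g := by
      rw [hg, ← hv]
      exact (Iso.inv_hom_id_app_assoc e (.mk A) _).symm
    rw [← RightHomotopyRel.iff_map_eq] at h2
    obtain ⟨P, _, ⟨h⟩⟩ := h2.exists_good_pathObject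
    have e0 : adj.homEquiv _ _ h.h ≫ G.map P.p₀ = v ≫ p := by
      rw [← Adjunction.homEquiv_naturality_right, h.h₀,
        Adjunction.homEquiv_naturality_left, Equiv.apply_symm_apply]
    have e1 : adj.homEquiv _ _ h.h ≫ G.map P.p₁ = sq.lift ≫ p := by
      rw [← Adjunction.homEquiv_naturality_right, h.h₁, sq.fac_right]
    have w0 : WeakEquivalence (G.map P.p₀) := hF.weakEquivalence_map_right adj P.p₀
    have wι : WeakEquivalence (G.map P.ι) :=
      weakEquivalence_of_postcomp_of_fac (g := G.map P.p₀) (fg := 𝟙 _)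
        (by rw [← G.map_comp, P.ι_p₀, G.map_id])
    have i1 : IsIso ((weakEquivalences D).Q.map (G.map P.ι)) :=
      Localization.inverts _ (weakEquivalences D) _ (mem_weakEquivalences _)
    have i2 : IsIso ((weakEquivalences D).Q.map p) :=
      Localization.inverts _ (weakEquivalences D) _ (mem_weakEquivalences _)
    rw [← cancel_mono ((weakEquivalences D).Q.map p), ← Functor.map_comp, ← Functor.map_comp,
      ← e0, ← e1, Functor.map_comp, Functor.map_comp]
    congr 1
    rw [← cancel_epi ((weakEquivalences D).Q.map (G.map P.ι)), ← Functor.map_comp,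
      ← Functor.map_comp, ← Functor.map_comp, ← Functor.map_comp, P.ι_p₀, P.ι_p₁]

lemma isLeftAdjoint_of_leftQuillen {F : D ⥤ D} (hF : IsLeftQuillen F)
    {F' : (weakEquivalences D).Localization ⥤ (weakEquivalences D).Localization}
    (e : (CofibrantObject.ι ⋙ (weakEquivalences D).Q) ⋙ F' ≅
      CofibrantObject.ι ⋙ F ⋙ (weakEquivalences D).Q) : F'.IsLeftAdjoint := by
  have := hF.isLeftAdjoint
  let adj := Adjunction.ofIsLeftAdjoint F
  suffices ∀ Y, HasTerminal (CostructuredArrow F' Y) from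
    isLeftAdjoint_of_costructuredArrowTerminals F'
  intro Y₀
  obtain ⟨Y, _, ⟨j⟩⟩ := exists_fibrant_iso Y₀
  obtain ⟨C, _, p, _, _⟩ := CofibrantObject.HoCat.exists_resolution (F.rightAdjoint.obj Y)
  have key (X : (weakEquivalences D).Localization) (f : F'.obj X ⟶ (weakEquivalences D).Q.obj Y) :
      ∃! u : X ⟶ (weakEquivalences D).Q.obj C, F'.map u ≫ e.hom.app (.mk C) ≫
        (weakEquivalences D).Q.map ((adj.homEquiv C Y).symm p) = f := by
    have := Localization.essSurj (CofibrantObject.ι ⋙ (weakEquivalences D).Q)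
      (weakEquivalences (CofibrantObject D))
    let A := (CofibrantObject.ι ⋙ (weakEquivalences D).Q).objPreimage X
    let i : (weakEquivalences D).Q.obj A.obj ≅ X :=
      (CofibrantObject.ι ⋙ (weakEquivalences D).Q).objObjPreimageIso X
    obtain ⟨u, hu, hu'⟩ := leftQuillen_universal hF adj e Y C p A.obj (F'.map i.hom ≫ f)
    refine ⟨i.inv ≫ u, ?_, ?_⟩
    · dsimp only at hu ⊢
      rw [Functor.map_comp, Category.assoc, hu, ← Functor.map_comp_assoc]
      simp
    · intro v hv
      dsimp only at hv hu'
      rw [Iso.eq_inv_comp]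
      apply hu'
      rw [Functor.map_comp, Category.assoc, hv]
  let φ := e.hom.app (.mk C) ≫ (weakEquivalences D).Q.map ((adj.homEquiv C Y).symm p) ≫ j.hom
  refine IsTerminal.hasTerminal (X := CostructuredArrow.mk (Y := (weakEquivalences D).Q.obj C) φ) ?_
  have ex (W : CostructuredArrow F' Y₀) := key W.left (W.hom ≫ j.inv)
  refine IsTerminal.ofUniqueHom (fun W ↦ CostructuredArrow.homMk (ex W).choose ?_) ?_
  · have := (ex W).choose_spec.1
    dsimp only at this
    simp only [φ, CostructuredArrow.mk_hom_eq_self]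
    rw [← Category.assoc _ _ j.hom, ← Category.assoc _ _ j.hom, this]
    simp
  · intro W m
    ext
    refine (ex W).choose_spec.2 _ ?_
    have := CostructuredArrow.w m
    simp only [φ, CostructuredArrow.mk_hom_eq_self] at this
    rw [← this]
    simp

end

section

section coxeter
variable {M : Type*} [Monoid M]

/-- The product `s a * s (a + 1) * ... * s (a + l - 1)`. -/
def ascProd (s : ℕ → M) : ℕ → ℕ → M
  | _, 0 => 1
  | a, l + 1 => s a * ascProd s (a + 1) l

/-- The elements `s 0, ..., s (n - 2)` satisfy the Coxeter relations of the symmetric group on `n`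
letters. -/
structure IsCoxeter (s : ℕ → M) (n : ℕ) : Prop where
  mul_self (i : ℕ) (hi : i + 1 < n) : s i * s i = 1
  comm (i j : ℕ) (hij : i + 1 < j) (hj : j + 1 < n) : s i * s j = s j * s i
  braid (i : ℕ) (hi : i + 2 < n) : s i * s (i + 1) * s i = s (i + 1) * s i * s (i + 1)

lemma IsCoxeter.mono {s : ℕ → M} {m n : ℕ} (h : IsCoxeter s n) (hmn : m ≤ n) : IsCoxeter s m where
  mul_self i hi := h.mul_self i (by omega)
  comm i j hij hj := h.comm i j hij (by omega)
  braid i hi := h.braid i (by omega)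

lemma IsCoxeter.comm_ascProd {s : ℕ → M} {n : ℕ} (h : IsCoxeter s n) (j : ℕ) :
    ∀ a l, j + 1 < a → a + l < n → s j * ascProd s a l = ascProd s a l * s j
  | a, 0, _, _ => by simp [ascProd]
  | a, l + 1, h1, h2 => by
    rw [ascProd, ← mul_assoc, h.comm j a h1 (by omega), mul_assoc,
      h.comm_ascProd j (a + 1) l (by omega) (by omega), mul_assoc]

lemma IsCoxeter.shift_ascProd {s : ℕ → M} {n : ℕ} (h : IsCoxeter s n) (j : ℕ) :
    ∀ a l, a ≤ j → j + 1 < a + l → a + l < n →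
      s (j + 1) * ascProd s a l = ascProd s a l * s j
  | a, 0, _, _, _ => by omega
  | a, l + 1, h1, h2, h3 => by
    rcases h1.eq_or_lt with rfl | h1
    · obtain ⟨l, rfl⟩ : ∃ l', l = l' + 1 := ⟨l - 1, by omega⟩
      have := h.comm_ascProd a (a + 1 + 1) l (by omega) (by omega)
      simp only [ascProd, mul_assoc]
      rw [← this]
      simp only [← mul_assoc]
      rw [h.braid a (by omega)]
    · rw [ascProd, ← mul_assoc, ← h.comm a (j + 1) (by omega) (by omega), mul_assoc,
        h.shift_ascProd j (a + 1) l (by omega) (by omega) (by omega), mul_assoc]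

/-- Indices of the normal forms of words in the generators of the symmetric group on `n`
letters. -/
def NormalForm : ℕ → Type
  | 0 => Unit
  | n + 1 => Fin (n + 1) × NormalForm n

instance : ∀ n, Fintype (NormalForm n)
  | 0 => inferInstanceAs (Fintype Unit)
  | n + 1 =>
    have := instFintypeNormalForm n
    inferInstanceAs (Fintype (Fin (n + 1) × NormalForm n))

lemma card_normalForm : ∀ n, Fintype.card (NormalForm n) = n.factorial
  | 0 => rfl
  | n + 1 => by
    have : Fintype.card (NormalForm (n + 1)) = Fintype.card (Fin (n + 1) × NormalForm n) := rfl
    rw [this, Fintype.card_prod, card_normalForm n, Fintype.card_fin, Nat.factorial_succ]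

/-- The element represented by a normal form. -/
def evalNormalForm (s : ℕ → M) : ∀ n, NormalForm n → M
  | 0, _ => 1
  | n + 1, x => ascProd s (n - x.1) x.1 * evalNormalForm s n x.2

lemma IsCoxeter.mul_mem_range {s : ℕ → M} : ∀ {n : ℕ} (_ : IsCoxeter s n) (j : ℕ) (_ : j + 1 < n)
    (x : NormalForm n), s j * evalNormalForm s n x ∈ Set.range (evalNormalForm s n)
  | 0, _, _, hj, _ => by omega
  | n + 1, h, j, hj, ⟨⟨l, hl⟩, x⟩ => by
    simp only [evalNormalForm]
    rw [← mul_assoc]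
    rcases lt_trichotomy (j + 1) (n - l) with h1 | h1 | h1
    · rw [h.comm_ascProd j _ _ h1 (by omega), mul_assoc]
      obtain ⟨y, hy⟩ := (h.mono n.le_succ).mul_mem_range j (by omega) x
      exact ⟨⟨⟨l, hl⟩, y⟩, by simp only [evalNormalForm, hy]⟩
    · refine ⟨⟨⟨l + 1, by omega⟩, x⟩, ?_⟩
      simp only [evalNormalForm]
      have h2 : n - (l + 1) = j := by omega
      rw [h2, ← h1, ascProd]
    · rcases (show n - l ≤ j by omega).eq_or_lt with h2 | h2
      · obtain ⟨l, rfl⟩ : ∃ l', l = l' + 1 := ⟨l - 1, by omega⟩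
        refine ⟨⟨⟨l, by omega⟩, x⟩, ?_⟩
        simp only [evalNormalForm]
        rw [h2, ascProd, ← mul_assoc (s j), h.mul_self j hj, one_mul]
        have h2 : n - l = j + 1 := by omega
        rw [h2]
      · obtain ⟨j, rfl⟩ : ∃ j', j = j' + 1 := ⟨j - 1, by omega⟩
        rw [h.shift_ascProd j _ _ (by omega) (by omega) (by omega), mul_assoc]
        obtain ⟨y, hy⟩ := (h.mono n.le_succ).mul_mem_range j (by omega) x
        exact ⟨⟨⟨l, hl⟩, y⟩, by simp only [evalNormalForm, hy]⟩

lemma one_mem_range (s : ℕ → M) : ∀ n, (1 : M) ∈ Set.range (evalNormalForm s n)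
  | 0 => ⟨(), rfl⟩
  | n + 1 => by
    obtain ⟨y, hy⟩ := one_mem_range s n
    exact ⟨⟨0, y⟩, by simp [evalNormalForm, hy, ascProd]⟩

lemma IsCoxeter.closure_subset {s : ℕ → M} {n : ℕ} (h : IsCoxeter s n) :
    (Submonoid.closure {x | ∃ i, i + 1 < n ∧ x = s i} : Set M) ⊆
      Set.range (evalNormalForm s n) := by
  intro x hx
  induction hx using Submonoid.closure_induction_left with
  | one => exact one_mem_range s n
  | mul_left x hx y hy ih =>
    obtain ⟨i, hi, rfl⟩ := hx
    obtain ⟨z, rfl⟩ := ih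
    exact h.mul_mem_range i hi z

/-- The adjacent transposition of `i` and `i + 1` as a permutation of `n` letters. -/
def adjTransposition (n i : ℕ) : Equiv.Perm (Fin n) :=
  if h : i + 1 < n then Equiv.swap ⟨i, by omega⟩ ⟨i + 1, h⟩ else 1

lemma swap_braid {α : Type*} [DecidableEq α] {a b c : α} (h1 : a ≠ b) (h2 : a ≠ c) (h3 : b ≠ c) :
    Equiv.swap a b * Equiv.swap b c * Equiv.swap a b =
      Equiv.swap b c * Equiv.swap a b * Equiv.swap b c := by
  have e1 := Equiv.swap_mul_swap_mul_swap h1 h2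
  have e2 := Equiv.swap_mul_swap_mul_swap h3.symm h2.symm
  rw [Equiv.swap_comm b a, Equiv.swap_comm c b, Equiv.swap_comm a c] at e2
  exact e2.trans e1.symm

lemma isCoxeter_adjTransposition (n : ℕ) : IsCoxeter (adjTransposition n) n where
  mul_self i hi := by simp [adjTransposition, hi]
  comm i j hij hj := by
    have hi : i + 1 < n := by omega
    simp only [adjTransposition, hi, hj, dif_pos]
    refine (Equiv.Perm.disjoint_swap_swap ?_).commute
    simp [Fin.ext_iff]
    omega
  braid i hi := by
    have hi1 : i + 1 < n := by omega
    simp only [adjTransposition, hi, hi1, dif_pos]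
    have h1 : (⟨i, by omega⟩ : Fin n) ≠ ⟨i + 1, hi1⟩ := by simp
    have h2 : (⟨i, by omega⟩ : Fin n) ≠ ⟨i + 1 + 1, hi⟩ := by simp [add_assoc]
    have h3 : (⟨i + 1, hi1⟩ : Fin n) ≠ ⟨i + 1 + 1, hi⟩ := by simp
    exact swap_braid h1 h2 h3

lemma closure_adjTransposition (n : ℕ) :
    Submonoid.closure {x | ∃ i, i + 1 < n ∧ x = adjTransposition n i} = ⊤ := by
  cases n with
  | zero => exact Subsingleton.elim _ _
  | succ n =>
    rw [← Equiv.Perm.mclosure_swap_castSucc_succ n]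
    congr 1
    ext x
    simp only [Set.mem_ofPred_eq, Set.mem_range]
    constructor
    · rintro ⟨i, hi, rfl⟩
      exact ⟨⟨i, by omega⟩, by simp [adjTransposition, hi]⟩
    · rintro ⟨i, rfl⟩
      exact ⟨i, by omega, by simp [adjTransposition]; rfl⟩

/-- Elements which satisfy the Coxeter relations define a homomorphism on the symmetric group. -/
lemma IsCoxeter.exists_hom {s : ℕ → M} {n : ℕ} (h : IsCoxeter s n) :
    ∃ φ : Equiv.Perm (Fin n) →* M, ∀ i, i + 1 < n → φ (adjTransposition n i) = s i := by
  let S : ℕ → Equiv.Perm (Fin n) × M := fun i ↦ (adjTransposition n i, s i)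
  have hp := isCoxeter_adjTransposition n
  have hS : IsCoxeter S n :=
    { mul_self i hi := Prod.ext (hp.mul_self i hi) (h.mul_self i hi)
      comm i j hij hj := Prod.ext (hp.comm i j hij hj) (h.comm i j hij hj)
      braid i hi := Prod.ext (hp.braid i hi) (h.braid i hi) }
  let G := Submonoid.closure {x | ∃ i, i + 1 < n ∧ x = S i}
  have hG := hS.closure_subset
  have : Finite G := (Set.finite_range (evalNormalForm S n)).subset hG
  have hcard : Nat.card G ≤ Nat.card (Equiv.Perm (Fin n)) := by
    calc Nat.card G ≤ Nat.card (Set.range (evalNormalForm S n)) :=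
          Nat.card_mono (Set.finite_range _) hG
      _ ≤ Nat.card (NormalForm n) := Finite.card_range_le _
      _ = Nat.card (Equiv.Perm (Fin n)) := by
          rw [Nat.card_eq_fintype_card, card_normalForm, Nat.card_eq_fintype_card,
            Fintype.card_perm, Fintype.card_fin]
  let p : G →* Equiv.Perm (Fin n) := (MonoidHom.fst _ _).comp G.subtype
  have hsurj : Function.Surjective p := by
    rw [← MonoidHom.mrange_eq_top, eq_top_iff, ← closure_adjTransposition n,
      Submonoid.closure_le]
    rintro _ ⟨i, hi, rfl⟩
    exact ⟨⟨S i, Submonoid.subset_closure ⟨i, hi, rfl⟩⟩, rfl⟩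
  have hbij : Function.Bijective p :=
    (Nat.bijective_iff_surjective_and_card p).mpr ⟨hsurj,
      le_antisymm hcard (Nat.card_le_card_of_surjective p hsurj)⟩
  let e := MulEquiv.ofBijective p hbij
  refine ⟨((MonoidHom.snd _ _).comp G.subtype).comp e.symm.toMonoidHom, fun i hi ↦ ?_⟩
  have : e.symm (adjTransposition n i) = ⟨S i, Submonoid.subset_closure ⟨i, hi, rfl⟩⟩ := by
    rw [MulEquiv.symm_apply_eq]
    rfl
  change (G.subtype (e.symm (adjTransposition n i))).2 = _
  rw [this]
  rfl

end coxeter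
variable {D : Type u} [Category.{v} D] [MonoidalCategory D] [SymmetricCategory D] (T : D)

/-- The functor `A ↦ A ∧ T ^ k`, bracketed to the left: `((A ∧ T) ∧ T) ∧ ... ∧ T`. -/
def smashPow : ℕ → D ⥤ D
  | 0 => 𝟭 D
  | k + 1 => smashPow k ⋙ tensorRight T

/-- The exchange of the two factors `T` of `(A ∧ T) ∧ T` by means of the symmetry. -/
def swapHom (A : D) : (A ⊗ T) ⊗ T ⟶ (A ⊗ T) ⊗ T :=
  (α_ A T T).hom ≫ A ◁ (β_ T T).hom ≫ (α_ A T T).inv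

lemma swapHom_naturality {A B : D} (f : A ⟶ B) :
    (f ▷ T) ▷ T ≫ swapHom T B = swapHom T A ≫ (f ▷ T) ▷ T := by
  simp only [swapHom]
  rw [associator_naturality_left_assoc, ← whisker_exchange_assoc,
    associator_inv_naturality_left, Category.assoc, Category.assoc]

lemma swapHom_swapHom (A : D) : swapHom T A ≫ swapHom T A = 𝟙 _ := by
  simp [swapHom, ← whiskerLeft_comp_assoc]

lemma swapHom_braid (A : D) :
    swapHom T A ▷ T ≫ swapHom T (A ⊗ T) ≫ swapHom T A ▷ T =
      swapHom T (A ⊗ T) ≫ swapHom T A ▷ T ≫ swapHom T (A ⊗ T) := by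
  have h1 : swapHom T A ▷ T = 𝟙 _ ⊗≫ A ◁ ((β_ T T).hom ▷ T) ⊗≫ 𝟙 _ := by
    simp only [swapHom]
    monoidal
  have h2 : swapHom T (A ⊗ T) = 𝟙 _ ⊗≫ A ◁ (T ◁ (β_ T T).hom) ⊗≫ 𝟙 _ := by
    simp only [swapHom]
    monoidal
  have h3 : 𝟙 _ ⊗≫ A ◁ ((β_ T T).hom ▷ T ⊗≫ T ◁ (β_ T T).hom ⊗≫ (β_ T T).hom ▷ T) ⊗≫ 𝟙 _ =
      swapHom T A ▷ T ≫ swapHom T (A ⊗ T) ≫ swapHom T A ▷ T := by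
    rw [h1, h2]
    monoidal
  rw [← h3, BraidedCategory.yang_baxter', h1, h2]
  monoidal

/-- The exchange of the two factors `T` of `(A ∧ T) ∧ T` as a natural transformation. -/
def swapLast : tensorRight T ⋙ tensorRight T ⟶ tensorRight T ⋙ tensorRight T where
  app A := swapHom T A
  naturality _ _ f := swapHom_naturality T f

/-- The exchange of the factors `T` at the positions `i` and `i + 1` of `A ∧ T ^ k`, where the
positions are numbered `0, ..., k - 1` from the left. -/
def adjSwap : (k : ℕ) → ℕ → (smashPow T k ⟶ smashPow T k)
  | 0, _ => 𝟙 _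
  | 1, _ => 𝟙 _
  | k + 2, i => if i = k then Functor.whiskerLeft (smashPow T k) (swapLast T)
      else Functor.whiskerRight (adjSwap (k + 1) i) (tensorRight T)

lemma adjSwap_last (k : ℕ) (A : D) : (adjSwap T (k + 2) k).app A =
    (swapLast T).app ((smashPow T k).obj A) :=
  congr_arg (fun f : smashPow T (k + 2) ⟶ smashPow T (k + 2) ↦ f.app A) (if_pos rfl)

lemma adjSwap_succ (k i : ℕ) (h : i + 1 < k) (A : D) : (adjSwap T (k + 1) i).app A =
    (adjSwap T k i).app A ▷ T := by
  obtain ⟨k, rfl⟩ : ∃ l, k = l + 1 := ⟨k - 1, by omega⟩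
  exact congr_arg (fun f : smashPow T (k + 2) ⟶ smashPow T (k + 2) ↦ f.app A) (if_neg (by omega))

lemma isCoxeter_adjSwap (k : ℕ) : IsCoxeter (M := End (smashPow T k)) (adjSwap T k) k := by
  induction k with
  | zero => exact ⟨by omega, by omega, by omega⟩
  | succ k ih =>
    have wc {A : D} (f g : (smashPow T k).obj A ⟶ (smashPow T k).obj A) :
        f ▷ T ≫ g ▷ T = (f ≫ g) ▷ T := (comp_whiskerRight f g T).symm
    constructor
    · intro i hi
      refine NatTrans.ext (funext fun A ↦ ?_)
      change (adjSwap T (k + 1) i).app A ≫ (adjSwap T (k + 1) i).app A = 𝟙 _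
      rcases Nat.lt_or_ge (i + 1) k with h | h
      · have := congr_arg (fun f ↦ NatTrans.app f A) (ih.mul_self i h)
        change (adjSwap T k i).app A ≫ (adjSwap T k i).app A = 𝟙 _ at this
        rw [adjSwap_succ T _ _ h]
        refine (wc _ _).trans ?_
        rw [this]
        exact id_whiskerRight _ _
      · obtain rfl : k = i + 1 := by omega
        rw [adjSwap_last]
        exact swapHom_swapHom T _
    · intro i j hij hj
      refine NatTrans.ext (funext fun A ↦ ?_)
      change (adjSwap T (k + 1) j).app A ≫ (adjSwap T (k + 1) i).app A =
        (adjSwap T (k + 1) i).app A ≫ (adjSwap T (k + 1) j).app A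
      rcases Nat.lt_or_ge (j + 1) k with h | h
      · have := congr_arg (fun f ↦ NatTrans.app f A) (ih.comm i j hij h)
        change (adjSwap T k j).app A ≫ (adjSwap T k i).app A =
          (adjSwap T k i).app A ≫ (adjSwap T k j).app A at this
        rw [adjSwap_succ T _ _ h, adjSwap_succ T k i (by omega)]
        refine (wc _ _).trans (Eq.trans ?_ (wc _ _).symm)
        rw [this]
      · obtain rfl : k = j + 1 := by omega
        rw [adjSwap_last, adjSwap_succ T (j + 1) i (by omega), adjSwap_succ T j i (by omega)]
        exact ((swapLast T).naturality ((adjSwap T j i).app A)).symm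
    · intro i hi
      refine NatTrans.ext (funext fun A ↦ ?_)
      change ((adjSwap T (k + 1) i).app A ≫ (adjSwap T (k + 1) (i + 1)).app A ≫
        (adjSwap T (k + 1) i).app A) = (adjSwap T (k + 1) (i + 1)).app A ≫
        (adjSwap T (k + 1) i).app A ≫ (adjSwap T (k + 1) (i + 1)).app A
      rcases Nat.lt_or_ge (i + 2) k with h | h
      · have := congr_arg (fun f ↦ NatTrans.app f A) (ih.braid i h)
        change (adjSwap T k i).app A ≫ (adjSwap T k (i + 1)).app A ≫ (adjSwap T k i).app A =
          (adjSwap T k (i + 1)).app A ≫ (adjSwap T k i).app A ≫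
            (adjSwap T k (i + 1)).app A at this
        rw [adjSwap_succ T k _ h, adjSwap_succ T k i (by omega)]
        refine ((congr_arg _ (wc _ _)).trans (wc _ _)).trans
          (Eq.trans ?_ ((congr_arg _ (wc _ _)).trans (wc _ _)).symm)
        rw [this]
      · obtain rfl : k = i + 2 := by omega
        rw [adjSwap_last, adjSwap_succ T (i + 2) i (by omega), adjSwap_last]
        exact swapHom_braid T _

/-- The left action of the symmetric group on `A ∧ T ^ k` by permutations of the factors `T`: the
unique homomorphism that maps the transposition of `i` and `i + 1` to the exchange of the factors
at these positions by means of the symmetry of the monoidal structure. -/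
def permAction (k : ℕ) : Equiv.Perm (Fin k) →* End (smashPow T k) :=
  (isCoxeter_adjSwap T k).exists_hom.choose

lemma permAction_adjTransposition (k i : ℕ) (hi : i + 1 < k) :
    permAction T k (adjTransposition k i) = adjSwap T k i :=
  (isCoxeter_adjSwap T k).exists_hom.choose_spec i hi

end

section

section ho
variable (D : Type u) [Category.{v} D] [ModelCategory D]

/-- The homotopy category `Ho(D)`. -/
abbrev Ho : Type u := (weakEquivalences D).Localization

/-- The localization functor `D ⥤ Ho(D)`. -/
abbrev toHo : D ⥤ Ho D := (weakEquivalences D).Q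

end ho

section fractions
variable {D : Type u} [Category.{v} D] [ModelCategory D]

lemma isIso_toHo_map {A B : D} (f : A ⟶ B) [WeakEquivalence f] : IsIso ((toHo D).map f) :=
  Localization.inverts (toHo D) (weakEquivalences D) _ (mem_weakEquivalences f)

/-- Morphisms in the homotopy category out of a cofibrant object are fractions. -/
lemma exists_fraction {A B : D} [IsCofibrant A] (w : (toHo D).obj A ⟶ (toHo D).obj B) :
    ∃ (B' : D) (g : A ⟶ B') (j : B ⟶ B') (_ : WeakEquivalence j) (_ : Cofibration j),
      w ≫ (toHo D).map j = (toHo D).map g := by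
  have h := MorphismProperty.factorizationData (trivialCofibrations D) (fibrations D)
    (terminal.from B)
  have : IsFibrant h.Z := by
    rw [isFibrant_iff, Subsingleton.elim (terminal.from h.Z) h.p]
    infer_instance
  obtain ⟨g, hg⟩ := map_surjective_of_isLocalization (toHo D) A h.Z (w ≫ (toHo D).map h.i)
  exact ⟨h.Z, g, h.i, inferInstance, inferInstance, hg.symm⟩

lemma isCofibrant_codomain {A B : D} (j : A ⟶ B) [Cofibration j] [IsCofibrant A] :
    IsCofibrant B := by
  rw [isCofibrant_iff, Subsingleton.elim (initial.to B) (initial.to A ≫ j)]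
  infer_instance

end fractions

section cogroup
variable {C : Type*} [Category* C]

/-- A cogroup structure on an object `A`: a group structure on the set of morphisms out of `A`
that is natural in the target. -/
structure CogroupStructure (A : C) where
  group (Y : C) : Group (A ⟶ Y)
  mul_comp {Y Z : C} (f g : A ⟶ Y) (h : Y ⟶ Z) :
    (group Y).mul f g ≫ h = (group Z).mul (f ≫ h) (g ≫ h)

/-- The image of a cogroup object under a left adjoint functor. -/
def CogroupStructure.map {A : C} (c : CogroupStructure A) (F : C ⥤ C) [F.IsLeftAdjoint] :
    CogroupStructure (F.obj A) where
  group Y :=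
    letI := c.group (F.rightAdjoint.obj Y)
    ((Adjunction.ofIsLeftAdjoint F).homEquiv A Y).group
  mul_comp {Y Z} f g h := by
    let _ := c.group (F.rightAdjoint.obj Y)
    let _ := c.group (F.rightAdjoint.obj Z)
    let adj := Adjunction.ofIsLeftAdjoint F
    change (adj.homEquiv A Y).symm (adj.homEquiv A Y f * adj.homEquiv A Y g) ≫ h =
      (adj.homEquiv A Z).symm (adj.homEquiv A Z (f ≫ h) * adj.homEquiv A Z (g ≫ h))
    rw [← adj.homEquiv_naturality_right_symm, adj.homEquiv_naturality_right,
      adj.homEquiv_naturality_right]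
    exact congr_arg _ (c.mul_comp _ _ _)

/-- A left adjoint functor induces group homomorphisms on morphisms out of a cogroup object. -/
lemma CogroupStructure.map_mul {A : C} (c : CogroupStructure A) (F : C ⥤ C) [F.IsLeftAdjoint]
    {Y : C} (f g : A ⟶ Y) :
    F.map ((c.group Y).mul f g) = ((c.map F).group (F.obj Y)).mul (F.map f) (F.map g) := by
  let _ := c.group (F.rightAdjoint.obj (F.obj Y))
  let adj := Adjunction.ofIsLeftAdjoint F
  change _ = (adj.homEquiv A _).symm (adj.homEquiv A _ (F.map f) * adj.homEquiv A _ (F.map g))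
  rw [Equiv.eq_symm_apply]
  have h (f : A ⟶ Y) : adj.homEquiv A _ (F.map f) = f ≫ adj.unit.app Y := by
    simp [Adjunction.homEquiv_unit]
  rw [h, h, h]
  exact c.mul_comp f g _

end cogroup

section tower
variable {G : ℕ → Type*} [∀ n, Group (G n)] (f : ∀ n, G n →* G (n + 1))

/-- The composites of the transition maps of a sequence of groups `G 0 → G 1 → ...`. -/
def towerMap (m n : ℕ) (h : m ≤ n) : G m →* G n :=
  Nat.leRec (motive := fun n _ ↦ G m →* G n) (MonoidHom.id _) (fun k _ g ↦ (f k).comp g) h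

@[simp]
lemma towerMap_self (m : ℕ) : towerMap f m m le_rfl = MonoidHom.id _ := Nat.leRec_self _ _

lemma towerMap_succ (m n : ℕ) (h : m ≤ n) :
    towerMap f m (n + 1) (h.trans n.le_succ) = (f n).comp (towerMap f m n h) :=
  Nat.leRec_succ _ _ _

lemma towerMap_succ_apply (m n : ℕ) (h : m ≤ n) (x : G m) :
    towerMap f m (n + 1) (h.trans n.le_succ) x = f n (towerMap f m n h x) :=
  DFunLike.congr_fun (towerMap_succ f m n h) x

lemma towerMap_towerMap (l m n : ℕ) (h : l ≤ m) (h' : m ≤ n) (x : G l) :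
    towerMap f m n h' (towerMap f l m h x) = towerMap f l n (h.trans h') x := by
  induction n, h' using Nat.le_induction with
  | base => simp
  | succ n h' ih => rw [towerMap_succ_apply _ _ _ h', ih, towerMap_succ_apply _ _ _ (h.trans h')]

instance : DirectedSystem G (towerMap f · · ·) where
  map_self _ _ := by simp
  map_map _ _ _ hij hjk x := towerMap_towerMap f _ _ _ hij hjk x

end tower

variable {D : Type u} [Category.{v} D] [ModelCategory D] [MonoidalCategory D]

section smash
variable (T : D) [SmashPreservesWeakEquivalences T]

lemma inverts_tensorRight : (weakEquivalences D).IsInvertedBy (tensorRight T ⋙ toHo D) := by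
  intro X Y f hf
  have : WeakEquivalence f := ⟨hf⟩
  have : WeakEquivalence (f ▷ T) := SmashPreservesWeakEquivalences.whiskerRight f
  exact Localization.inverts (toHo D) (weakEquivalences D) _ (mem_weakEquivalences (f ▷ T))

/-- The functor `- ∧ T` on the homotopy category. -/
def hoSmash : Ho D ⥤ Ho D :=
  Localization.lift (tensorRight T ⋙ toHo D) (inverts_tensorRight T) (toHo D)

/-- The functor `- ∧ T` on the homotopy category is induced by `- ⊗ T`. -/
def hoSmashFac : toHo D ⋙ hoSmash T ≅ tensorRight T ⋙ toHo D :=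
  Localization.fac _ (inverts_tensorRight T) _

/-- In the homotopy category, `A ∧ T` is represented by `A ⊗ T`. -/
def hoSmashIso (A : D) : (hoSmash T).obj ((toHo D).obj A) ≅ (toHo D).obj (A ⊗ T) :=
  (hoSmashFac T).app A

lemma hoSmashIso_naturality {A B : D} (f : A ⟶ B) :
    (hoSmash T).map ((toHo D).map f) ≫ (hoSmashIso T B).hom =
      (hoSmashIso T A).hom ≫ (toHo D).map (f ▷ T) :=
  (hoSmashFac T).hom.naturality f

/-- The functor `- ∧ T` applied to a morphism in the homotopy category between objects of `D`. -/
def smashHo {A B : D} (u : (toHo D).obj A ⟶ (toHo D).obj B) :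
    (toHo D).obj (A ⊗ T) ⟶ (toHo D).obj (B ⊗ T) :=
  (hoSmashIso T A).inv ≫ (hoSmash T).map u ≫ (hoSmashIso T B).hom

@[simp]
lemma smashHo_map {A B : D} (f : A ⟶ B) :
    smashHo T ((toHo D).map f) = (toHo D).map (f ▷ T) := by
  simp [smashHo, hoSmashIso_naturality]

lemma smashHo_comp {A B C : D} (f : (toHo D).obj A ⟶ (toHo D).obj B)
    (g : (toHo D).obj B ⟶ (toHo D).obj C) :
    smashHo T (f ≫ g) = smashHo T f ≫ smashHo T g := by
  simp [smashHo]

end smash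

section leftSmash
variable [SymmetricCategory D] [MonoidalClosed D] [MonoidalModelCategory D]
variable (V : D) [IsCofibrant V]

/-- The left derived functor of `V ∧ -` for a cofibrant object `V`. -/
def hoLeftSmash : Ho D ⥤ Ho D := leftDerived (isLeftQuillen_tensorLeft V)

instance : (hoLeftSmash V).IsLeftAdjoint :=
  isLeftAdjoint_of_leftQuillen (isLeftQuillen_tensorLeft V) (leftDerivedIso _)

instance (T : D) [IsCofibrant T] [SmashPreservesWeakEquivalences T] :
    (hoSmash T).IsLeftAdjoint :=
  isLeftAdjoint_of_leftQuillen (isLeftQuillen_tensorRight T)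
    (Functor.isoWhiskerLeft CofibrantObject.ι (hoSmashFac T))

/-- For cofibrant `V` and `A`, the derived smash product of `V` and `A` is represented
by `V ⊗ A`. -/
def hoLeftSmashIso (A : D) [IsCofibrant A] :
    (hoLeftSmash V).obj ((toHo D).obj A) ≅ (toHo D).obj (V ⊗ A) :=
  (leftDerivedIso (isLeftQuillen_tensorLeft V)).app (.mk A)

lemma hoLeftSmashIso_naturality {A B : D} [IsCofibrant A] [IsCofibrant B] (f : A ⟶ B) :
    (hoLeftSmash V).map ((toHo D).map f) ≫ (hoLeftSmashIso V B).hom =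
      (hoLeftSmashIso V A).hom ≫ (toHo D).map (V ◁ f) :=
  (leftDerivedIso (isLeftQuillen_tensorLeft V)).hom.naturality (CofibrantObject.homMk f)

/-- The functor `V ∧ -` applied to a morphism in the homotopy category between cofibrant objects
of `D`. -/
def leftSmashHo {A B : D} [IsCofibrant A] [IsCofibrant B]
    (u : (toHo D).obj A ⟶ (toHo D).obj B) : (toHo D).obj (V ⊗ A) ⟶ (toHo D).obj (V ⊗ B) :=
  (hoLeftSmashIso V A).inv ≫ (hoLeftSmash V).map u ≫ (hoLeftSmashIso V B).hom

@[simp]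
lemma leftSmashHo_map {A B : D} [IsCofibrant A] [IsCofibrant B] (f : A ⟶ B) :
    leftSmashHo V ((toHo D).map f) = (toHo D).map (V ◁ f) := by
  simp [leftSmashHo, hoLeftSmashIso_naturality]

lemma leftSmashHo_comp {A B C : D} [IsCofibrant A] [IsCofibrant B] [IsCofibrant C]
    (f : (toHo D).obj A ⟶ (toHo D).obj B) (g : (toHo D).obj B ⟶ (toHo D).obj C) :
    leftSmashHo V (f ≫ g) = leftSmashHo V f ≫ leftSmashHo V g := by
  simp [leftSmashHo]

instance isCofibrant_tensor (A : D) [IsCofibrant A] : IsCofibrant (V ⊗ A) :=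
  (isLeftQuillen_tensorLeft V).isCofibrant A

variable (T : D) [IsCofibrant T] [SmashPreservesWeakEquivalences T]

lemma smashHo_leftSmashHo {A B : D} [IsCofibrant A] [IsCofibrant B]
    (w : (toHo D).obj A ⟶ (toHo D).obj B) :
    smashHo T (leftSmashHo V w) ≫ (toHo D).map (α_ V B T).hom =
      (toHo D).map (α_ V A T).hom ≫ leftSmashHo V (smashHo T w) := by
  obtain ⟨B', g, j, _, _, e⟩ := exists_fraction w
  have := isCofibrant_codomain j
  have h1 := congr_arg (fun w ↦ smashHo T (leftSmashHo V w)) e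
  have h2 := congr_arg (fun w ↦ leftSmashHo V (smashHo T w)) e
  simp only [smashHo_comp, leftSmashHo_comp, smashHo_map, leftSmashHo_map] at h1 h2
  have : WeakEquivalence (V ◁ (j ▷ T)) := by
    have : WeakEquivalence (j ▷ T) := SmashPreservesWeakEquivalences.whiskerRight j
    have : Cofibration (j ▷ T) := (isLeftQuillen_tensorRight T).cofibration j
    exact (isLeftQuillen_tensorLeft V).weakEquivalence (j ▷ T)
  have := isIso_toHo_map (V ◁ (j ▷ T))
  rw [← cancel_mono ((toHo D).map (V ◁ (j ▷ T))), Category.assoc, Category.assoc, h2,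
    ← Functor.map_comp, ← Functor.map_comp, ← associator_naturality_middle, Functor.map_comp,
    reassoc_of% h1, ← Functor.map_comp, associator_naturality_middle]

lemma leftSmashHo_leftSmashHo (W : D) [IsCofibrant W] {A B : D} [IsCofibrant A] [IsCofibrant B]
    (w : (toHo D).obj A ⟶ (toHo D).obj B) :
    leftSmashHo (V ⊗ W) w ≫ (toHo D).map (α_ V W B).hom =
      (toHo D).map (α_ V W A).hom ≫ leftSmashHo V (leftSmashHo W w) := by
  obtain ⟨B', g, j, _, _, e⟩ := exists_fraction w
  have := isCofibrant_codomain j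
  have h1 := congr_arg (fun w ↦ leftSmashHo (V ⊗ W) w) e
  have h2 := congr_arg (fun w ↦ leftSmashHo V (leftSmashHo W w)) e
  simp only [leftSmashHo_comp, leftSmashHo_map] at h1 h2
  have : WeakEquivalence (V ◁ (W ◁ j)) := by
    have : WeakEquivalence (W ◁ j) := (isLeftQuillen_tensorLeft W).weakEquivalence j
    have : Cofibration (W ◁ j) := (isLeftQuillen_tensorLeft W).cofibration j
    exact (isLeftQuillen_tensorLeft V).weakEquivalence (W ◁ j)
  have := isIso_toHo_map (V ◁ (W ◁ j))
  rw [← cancel_mono ((toHo D).map (V ◁ (W ◁ j))), Category.assoc, Category.assoc, h2,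
    ← Functor.map_comp, ← Functor.map_comp, ← associator_naturality_right, Functor.map_comp,
    reassoc_of% h1, ← Functor.map_comp, associator_naturality_right]

end leftSmash

section
variable [SymmetricCategory D] (T : D) [SmashPreservesWeakEquivalences T]

lemma swapHom_natural {A B : D} [IsCofibrant A] (w : (toHo D).obj A ⟶ (toHo D).obj B) :
    smashHo T (smashHo T w) ≫ (toHo D).map (swapHom T B) =
      (toHo D).map (swapHom T A) ≫ smashHo T (smashHo T w) := by
  obtain ⟨B', g, j, _, _, e⟩ := exists_fraction w
  have h1 := congr_arg (fun w ↦ smashHo T (smashHo T w)) e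
  simp only [smashHo_comp, smashHo_map] at h1
  have : WeakEquivalence (j ▷ T) := SmashPreservesWeakEquivalences.whiskerRight j
  have : WeakEquivalence (j ▷ T ▷ T) := SmashPreservesWeakEquivalences.whiskerRight (j ▷ T)
  have := isIso_toHo_map (j ▷ T ▷ T)
  rw [← cancel_mono ((toHo D).map (j ▷ T ▷ T)), Category.assoc, Category.assoc, h1,
    ← Functor.map_comp, ← Functor.map_comp, ← swapHom_naturality, Functor.map_comp,
    reassoc_of% h1, ← Functor.map_comp, swapHom_naturality]

end

end

section

/-- The permutation `γ × τ` of `n + p` letters. -/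
def blockSum {n p : ℕ} (γ : Equiv.Perm (Fin n)) (τ : Equiv.Perm (Fin p)) :
    Equiv.Perm (Fin (n + p)) :=
  finSumFinEquiv.permCongr (Equiv.Perm.sumCongr γ τ)

variable {D : Type u} [Category.{v} D] [ModelCategory D] [MonoidalCategory D]
  [SymmetricCategory D]

section spectra

/-- The iterated structure map `X n ∧ T ^ p ⟶ X (n + p)` of a sequence of objects `X n` with
structure maps `X n ∧ T ⟶ X (n + 1)`. -/
def iterStructureMap {T : D} {X : ℕ → D} (σ : ∀ n, X n ⊗ T ⟶ X (n + 1)) (n : ℕ) :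
    ∀ p : ℕ, (smashPow T p).obj (X n) ⟶ X (n + p)
  | 0 => 𝟙 _
  | p + 1 => iterStructureMap σ n p ▷ T ≫ σ (n + p)

/-- A symmetric `T`-spectrum: a sequence of objects `X n` with left actions of the symmetric groups
and structure maps `X n ∧ T ⟶ X (n + 1)` whose iterates `X n ∧ T ^ p ⟶ X (n + p)` are equivariant
for the action of the product of the symmetric groups on `n` and on `p` letters. -/
structure SymmetricSpectrum (T : D) where
  obj (n : ℕ) : D
  act (n : ℕ) : Equiv.Perm (Fin n) →* End (obj n)
  structureMap (n : ℕ) : obj n ⊗ T ⟶ obj (n + 1)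
  equivariant (n p : ℕ) (γ : Equiv.Perm (Fin n)) (τ : Equiv.Perm (Fin p)) :
    (smashPow T p).map (act n γ) ≫ (permAction T p τ).app (obj n) ≫
        iterStructureMap structureMap n p =
      iterStructureMap structureMap n p ≫ act (n + p) (blockSum γ τ)

end spectra

section sign
variable (T : D) [SmashPreservesWeakEquivalences T]

/-- `T ^ (n + 1)`, bracketed to the left. -/
abbrev power (n : ℕ) : D := (smashPow T n).obj T

/-- The identification of `𝟙 ∧ T ^ (n + 1)` with `T ^ (n + 1)`. -/
def powerIso : ∀ n : ℕ, (smashPow T (n + 1)).obj (𝟙_ D) ≅ power T n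
  | 0 => λ_ T
  | n + 1 => whiskerRightIso (powerIso n) T

/-- The action of a permutation on `T ^ (n + 1)`. -/
def permPower (n : ℕ) (τ : Equiv.Perm (Fin (n + 1))) : power T n ⟶ power T n :=
  (powerIso T n).inv ≫ (permAction T (n + 1) τ).app (𝟙_ D) ≫ (powerIso T n).hom

/-- `u ∧ T ^ n` as an endomorphism of `T ^ (n + 1)` in the homotopy category. -/
def smashPowerHo (u : (toHo D).obj T ⟶ (toHo D).obj T) :
    ∀ n : ℕ, (toHo D).obj (power T n) ⟶ (toHo D).obj (power T n)
  | 0 => u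
  | n + 1 => smashHo T (smashPowerHo u n)

/-- The endomorphism `|τ|`: it is the identity if `τ` is even, and `neg` if `τ` is odd. -/
def signMap {C : Type*} [Category* C] {A : C} (neg : A ⟶ A) {n : ℕ} (τ : Equiv.Perm (Fin n)) :
    A ⟶ A :=
  if Equiv.Perm.sign τ = 1 then 𝟙 A else neg

lemma signMap_mul {C : Type*} [Category* C] {A : C} {neg : A ⟶ A} (h : neg ≫ neg = 𝟙 A) {n : ℕ}
    (γ τ : Equiv.Perm (Fin n)) :
    signMap neg (γ * τ) = signMap neg γ ≫ signMap neg τ := by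
  rcases Int.units_eq_one_or (Equiv.Perm.sign γ) with h1 | h1 <;>
    rcases Int.units_eq_one_or (Equiv.Perm.sign τ) with h2 | h2 <;>
    simp [signMap, h1, h2, h]

lemma sign_blockSum {n p : ℕ} (γ : Equiv.Perm (Fin n)) (τ : Equiv.Perm (Fin p)) :
    Equiv.Perm.sign (blockSum γ τ) = Equiv.Perm.sign γ * Equiv.Perm.sign τ := by
  simp [blockSum]

lemma signMap_blockSum_one {C : Type*} [Category* C] {A : C} (neg : A ⟶ A) {n p : ℕ}
    (γ : Equiv.Perm (Fin n)) :
    signMap neg (blockSum γ (1 : Equiv.Perm (Fin p))) = signMap neg γ := by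
  simp [signMap, sign_blockSum]

variable [MonoidalClosed D] [MonoidalModelCategory D] [IsCofibrant T]

/-- A sign of `T`: an automorphism `neg` of `T` of order two in the homotopy category such that
every permutation `τ` of the factors of `T ^ (n + 1)` equals `|τ| ∧ T ^ n` in the homotopy category,
and such that `neg ∧ T = T ∧ neg`. -/
structure Sign where
  neg : (toHo D).obj T ⟶ (toHo D).obj T
  neg_neg : neg ≫ neg = 𝟙 _
  perm (n : ℕ) (τ : Equiv.Perm (Fin (n + 1))) :
    (toHo D).map (permPower T n τ) = smashPowerHo T (signMap neg τ) n
  smash_neg : smashHo T neg = leftSmashHo T neg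

end sign

section stages
variable {T : D} [SmashPreservesWeakEquivalences T]

variable [MonoidalClosed D] [MonoidalModelCategory D]

variable (T) in
/-- The functor `V ∧ - ∧ T ^ k` on the homotopy category. -/
def sphereFunctor (V : D) [IsCofibrant V] : ℕ → (Ho D ⥤ Ho D)
  | 0 => hoLeftSmash V
  | k + 1 => sphereFunctor V k ⋙ hoSmash T

variable (T) in
/-- The object `V ∧ T ^ (k + 1)` of the homotopy category. -/
abbrev sphere (V : D) [IsCofibrant V] (k : ℕ) : Ho D := (sphereFunctor T V k).obj ((toHo D).obj T)


section hom
variable {V : D} [IsCofibrant V] (X : SymmetricSpectrum T)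

/-- The map `[V ∧ T ^ (k + 1), X m] ⟶ [V ∧ T ^ (k + 2), X (m + 1)]` given by smashing with `T`
and composing with the structure map. -/
def suspendHom (k m : ℕ) (x : sphere T V k ⟶ (toHo D).obj (X.obj m)) :
    sphere T V (k + 1) ⟶ (toHo D).obj (X.obj (m + 1)) :=
  (hoSmash T).map x ≫ (hoSmashIso T (X.obj m)).hom ≫ (toHo D).map (X.structureMap m)

variable {X} [IsCofibrant T] (s : Sign T)

/-- Precomposition with `V ∧ |γ| ∧ T ^ k` and postcomposition with the action of `γ`. -/
def permHom {k m : ℕ} (γ : Equiv.Perm (Fin m)) (x : sphere T V k ⟶ (toHo D).obj (X.obj m)) :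
    sphere T V k ⟶ (toHo D).obj (X.obj m) :=
  (sphereFunctor T V k).map (signMap s.neg γ) ≫ x ≫ (toHo D).map (X.act m γ)

lemma permHom_one {k m : ℕ} (x : sphere T V k ⟶ (toHo D).obj (X.obj m)) :
    permHom s 1 x = x := by
  have : (toHo D).map (X.act m 1) = 𝟙 _ := by
    rw [map_one]
    exact (toHo D).map_id _
  rw [permHom, this, signMap, map_one, if_pos rfl, CategoryTheory.Functor.map_id, Category.id_comp,
    Category.comp_id]

lemma permHom_mul {k m : ℕ} (γ δ : Equiv.Perm (Fin m))
    (x : sphere T V k ⟶ (toHo D).obj (X.obj m)) :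
    permHom s (γ * δ) x = permHom s γ (permHom s δ x) := by
  have : (toHo D).map (X.act m (γ * δ)) =
      (toHo D).map (X.act m δ) ≫ (toHo D).map (X.act m γ) := by
    rw [map_mul]
    exact (toHo D).map_comp _ _
  simp only [permHom, signMap_mul s.neg_neg, this, Functor.map_comp, Category.assoc]

lemma act_structureMap (X : SymmetricSpectrum T) (m : ℕ) (γ : Equiv.Perm (Fin m)) :
    (X.act m γ : X.obj m ⟶ X.obj m) ▷ T ≫ X.structureMap m =
      X.structureMap m ≫ X.act (m + 1) (blockSum γ (1 : Equiv.Perm (Fin 1))) := by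
  have h := X.equivariant m 1 γ 1
  rw [map_one] at h
  have h1 : iterStructureMap X.structureMap m 1 = X.structureMap m :=
    (congr_arg (· ≫ _) (id_whiskerRight _ _)).trans (Category.id_comp _)
  rw [h1] at h
  refine Eq.trans ?_ h
  congr 1
  exact (Category.id_comp _).symm

lemma permHom_suspendHom_aux {W : Ho D} {A B : D} (n : W ⟶ W) (x : W ⟶ (toHo D).obj A)
    (g : A ⟶ A) (σ : A ⊗ T ⟶ B) (g' : B ⟶ B) (h : g ▷ T ≫ σ = σ ≫ g') :
    (hoSmash T).map n ≫ ((hoSmash T).map x ≫ (hoSmashIso T A).hom ≫ (toHo D).map σ) ≫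
      (toHo D).map g' =
    (hoSmash T).map (n ≫ x ≫ (toHo D).map g) ≫ (hoSmashIso T A).hom ≫ (toHo D).map σ := by
  simp only [Functor.map_comp, Category.assoc]
  rw [← Functor.map_comp, ← h, Functor.map_comp, reassoc_of% hoSmashIso_naturality]

lemma permHom_suspendHom {k m : ℕ} (γ : Equiv.Perm (Fin m))
    (x : sphere T V k ⟶ (toHo D).obj (X.obj m)) :
    permHom s (blockSum γ (1 : Equiv.Perm (Fin 1))) (suspendHom X k m x) =
      suspendHom X k m (permHom s γ x) := by
  rw [permHom, signMap_blockSum_one]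
  exact permHom_suspendHom_aux _ x _ _ _ (act_structureMap X m γ)

lemma permPower_swap : permPower T 1 (adjTransposition 2 0) = (β_ T T).hom := by
  rw [permPower, permAction_adjTransposition T 2 0 (by omega), adjSwap_last]
  change (λ_ T).inv ▷ T ≫ ((α_ (𝟙_ D) T T).hom ≫ 𝟙_ D ◁ (β_ T T).hom ≫ (α_ (𝟙_ D) T T).inv) ≫
    (λ_ T).hom ▷ T = _
  simp

lemma sign_adjTransposition : Equiv.Perm.sign (adjTransposition 2 0) = -1 := by
  simp [adjTransposition]

lemma map_braiding : (toHo D).map (β_ T T).hom = smashHo T s.neg := by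
  have h := s.perm 1 (adjTransposition 2 0)
  rw [permPower_swap] at h
  refine h.trans ?_
  rw [signMap, sign_adjTransposition, if_neg (by decide)]
  rfl

lemma map_swapHom (A : D) [IsCofibrant A] :
    (toHo D).map (swapHom T A) = smashHo T (leftSmashHo A s.neg) := by
  rw [swapHom, Functor.map_comp, Functor.map_comp, ← leftSmashHo_map, map_braiding s,
    ← Category.assoc, ← smashHo_leftSmashHo, Category.assoc, ← Functor.map_comp]
  simp

lemma leftSmashHo_neg_tensor (A : D) [IsCofibrant A] :
    leftSmashHo (A ⊗ T) s.neg = smashHo T (leftSmashHo A s.neg) := by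
  rw [← cancel_mono ((toHo D).map (α_ A T T).hom), leftSmashHo_leftSmashHo, smashHo_leftSmashHo,
    s.smash_neg]

variable (T V) in
/-- `V ∧ T ^ (k + 1)` as an object of `D`. -/
def spherePre : ℕ → D
  | 0 => V ⊗ T
  | k + 1 => spherePre k ⊗ T

instance isCofibrant_spherePre : ∀ k, IsCofibrant (spherePre T V k)
  | 0 => inferInstanceAs (IsCofibrant (V ⊗ T))
  | k + 1 =>
    have := isCofibrant_spherePre k
    inferInstanceAs (IsCofibrant (spherePre T V k ⊗ T))

variable (T V) in
/-- The object `spherePre T V k` represents `V ∧ T ^ (k + 1)`. -/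
def sphereIso : ∀ k, sphere T V k ≅ (toHo D).obj (spherePre T V k)
  | 0 => hoLeftSmashIso V T
  | k + 1 => (hoSmash T).mapIso (sphereIso k) ≪≫ hoSmashIso T (spherePre T V k)

lemma sphereIso_aux {W : Ho D} {P A B : D} (w : W ≅ (toHo D).obj P) (x : W ⟶ (toHo D).obj A)
    (σ : A ⊗ T ⟶ B) :
    (hoSmash T).map x ≫ (hoSmashIso T A).hom ≫ (toHo D).map σ =
      ((hoSmash T).mapIso w ≪≫ hoSmashIso T P).hom ≫ smashHo T (w.inv ≫ x) ≫ (toHo D).map σ := by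
  simp [smashHo]

lemma sphereIso_aux' {W : Ho D} {P : D} (w : W ≅ (toHo D).obj P) (n : W ⟶ W) :
    smashHo T (w.inv ≫ n ≫ w.hom) = ((hoSmash T).mapIso w ≪≫ hoSmashIso T P).inv ≫
      (hoSmash T).map n ≫ ((hoSmash T).mapIso w ≪≫ hoSmashIso T P).hom := by
  simp [smashHo]

lemma leftSmashHo_spherePre (k : ℕ) :
    leftSmashHo (spherePre T V k) s.neg =
      smashHo T ((sphereIso T V k).inv ≫ (sphereFunctor T V k).map s.neg ≫
        (sphereIso T V k).hom) := by
  induction k with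
  | zero => exact leftSmashHo_neg_tensor s V
  | succ k ih =>
    refine (leftSmashHo_neg_tensor s (spherePre T V k)).trans (congr_arg _ ?_)
    rw [ih]
    exact sphereIso_aux' _ _

lemma suspendHom_eq {k m : ℕ} (x : sphere T V k ⟶ (toHo D).obj (X.obj m)) :
    suspendHom X k m x = (sphereIso T V (k + 1)).hom ≫ smashHo T ((sphereIso T V k).inv ≫ x) ≫
      (toHo D).map (X.structureMap m) :=
  sphereIso_aux _ _ _

variable (T V) in
/-- The isomorphism `sphereIso` for `V ∧ T ^ (k + 3)`. -/
def sphereIsoTwo (k : ℕ) :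
    sphere T V (k + 2) ≅ (toHo D).obj ((spherePre T V k ⊗ T) ⊗ T) :=
  sphereIso T V (k + 2)

lemma suspendHom_suspendHom_aux {W : Ho D} {P A B C : D}
    (w : W ≅ (toHo D).obj ((P ⊗ T) ⊗ T)) (y : (toHo D).obj P ⟶ (toHo D).obj A)
    (σ : A ⊗ T ⟶ B) (τ : B ⊗ T ⟶ C) :
    w.hom ≫ smashHo T (smashHo T y ≫ (toHo D).map σ) ≫ (toHo D).map τ =
      w.hom ≫ smashHo T (smashHo T y) ≫ (toHo D).map (σ ▷ T ≫ τ) := by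
  rw [smashHo_comp, smashHo_map, Functor.map_comp, Category.assoc]

lemma suspendHom_suspendHom {k m : ℕ} (x : sphere T V k ⟶ (toHo D).obj (X.obj m)) :
    suspendHom X (k + 1) (m + 1) (suspendHom X k m x) =
      (sphereIsoTwo T V k).hom ≫ smashHo T (smashHo T ((sphereIso T V k).inv ≫ x)) ≫
        (toHo D).map (X.structureMap m ▷ T ≫ X.structureMap (m + 1)) := by
  rw [suspendHom_eq, suspendHom_eq, Iso.inv_hom_id_assoc]
  exact suspendHom_suspendHom_aux _ _ _ _

lemma map_swapHom_spherePre (k : ℕ) :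
    (toHo D).map (swapHom T (spherePre T V k)) =
    (sphereIsoTwo T V k).inv ≫ (sphereFunctor T V (k + 2)).map s.neg ≫
      (sphereIsoTwo T V k).hom := by
  rw [map_swapHom s, leftSmashHo_spherePre]
  refine Eq.trans (congr_arg _ ?_) (sphereIso_aux' (sphereIso T V (k + 1)) _)
  exact sphereIso_aux' (sphereIso T V k) _

lemma permHom_swap_aux {W : Ho D} {P A B : D} [IsCofibrant P]
    (w : W ≅ (toHo D).obj ((P ⊗ T) ⊗ T)) (n : W ⟶ W)
    (y : (toHo D).obj P ⟶ (toHo D).obj A) (i : (A ⊗ T) ⊗ T ⟶ B) (g : B ⟶ B)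
    (hn : (toHo D).map (swapHom T P) = w.inv ≫ n ≫ w.hom) (hg : swapHom T A ≫ i = i ≫ g) :
    n ≫ (w.hom ≫ smashHo T (smashHo T y) ≫ (toHo D).map i) ≫ (toHo D).map g =
      w.hom ≫ smashHo T (smashHo T y) ≫ (toHo D).map i := by
  have hn : n ≫ w.hom = w.hom ≫ (toHo D).map (swapHom T P) := by rw [hn]; simp
  have h2 : (toHo D).map (swapHom T P) ≫ (toHo D).map (swapHom T P) = 𝟙 _ := by
    rw [← Functor.map_comp, swapHom_swapHom, CategoryTheory.Functor.map_id]
  simp only [Category.assoc]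
  rw [reassoc_of% hn, ← Functor.map_comp, ← hg, Functor.map_comp,
    reassoc_of% (swapHom_natural T y), reassoc_of% h2]

lemma permHom_swap {k m : ℕ} (x : sphere T V k ⟶ (toHo D).obj (X.obj m)) :
    permHom s (blockSum (1 : Equiv.Perm (Fin m)) (adjTransposition 2 0))
      (suspendHom X (k + 1) (m + 1) (suspendHom X k m x)) =
    suspendHom X (k + 1) (m + 1) (suspendHom X k m x) := by
  have h0 : iterStructureMap X.structureMap m 2 =
      X.structureMap m ▷ T ≫ X.structureMap (m + 1) := by
    refine congr_arg (· ▷ T ≫ X.structureMap (m + 1)) ?_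
    exact (congr_arg (· ≫ _) (id_whiskerRight _ _)).trans (Category.id_comp _)
  have h := X.equivariant m 2 1 (adjTransposition 2 0)
  rw [permAction_adjTransposition T 2 0 (by omega), adjSwap_last, map_one, h0] at h
  have h : swapHom T (X.obj m) ≫ X.structureMap m ▷ T ≫ X.structureMap (m + 1) =
      (X.structureMap m ▷ T ≫ X.structureMap (m + 1)) ≫
        X.act (m + 2) (blockSum 1 (adjTransposition 2 0)) := by
    refine Eq.trans ?_ h
    exact (Category.id_comp _).symm.trans
      (congr_arg (· ≫ _) ((smashPow T 2).map_id (X.obj m)).symm)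
  have hs : signMap s.neg (blockSum (1 : Equiv.Perm (Fin m)) (adjTransposition 2 0)) = s.neg := by
    simp [signMap, sign_blockSum, sign_adjTransposition]
  rw [permHom, suspendHom_suspendHom, hs]
  exact permHom_swap_aux _ _ _ _ _ (map_swapHom_spherePre s k) h

end hom

end stages

end

section

/-- The monoid of injective self-maps of `ℕ`. -/
abbrev InjectionMonoid : Type :=
  ({ carrier := {f | Function.Injective f}
     mul_mem' := fun hf hg ↦ hf.comp hg
     one_mem' := Function.injective_id } : Submonoid (Function.End ℕ))

lemma blockSum_val_of_lt {n p : ℕ} (γ : Equiv.Perm (Fin n)) (τ : Equiv.Perm (Fin p))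
    (i : Fin (n + p)) (h : (i : ℕ) < n) : (blockSum γ τ i : ℕ) = γ ⟨i, h⟩ := by
  obtain ⟨j, rfl⟩ : ∃ j, i = Fin.castAdd p j := ⟨⟨i, h⟩, rfl⟩
  simp [blockSum, Equiv.permCongr_apply]

lemma blockSum_val_of_le {n p : ℕ} (γ : Equiv.Perm (Fin n)) (τ : Equiv.Perm (Fin p))
    (i : Fin (n + p)) (h : n ≤ (i : ℕ)) : (blockSum γ τ i : ℕ) = n + τ ⟨i - n, by omega⟩ := by
  obtain ⟨j, rfl⟩ : ∃ j, i = Fin.natAdd n j :=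
    ⟨⟨i - n, by omega⟩, by ext; simp; omega⟩
  simp [blockSum, Equiv.permCongr_apply]

lemma adjTransposition_val {n i : ℕ} (h : i + 1 < n) (j : Fin n) :
    (adjTransposition n i j : ℕ) = if (j : ℕ) = i then i + 1 else if (j : ℕ) = i + 1 then i else j := by
  simp only [adjTransposition, h, dif_pos, Equiv.swap_apply_def, Fin.ext_iff]
  split_ifs <;> simp

lemma blockSum_adjTransposition {n i : ℕ} (h : i + 1 < n) :
    blockSum (adjTransposition n i) (1 : Equiv.Perm (Fin 1)) = adjTransposition (n + 1) i := by
  ext j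
  rw [adjTransposition_val (by omega)]
  rcases Nat.lt_or_ge j n with hj | hj
  · rw [blockSum_val_of_lt _ _ _ hj, adjTransposition_val h]
  · rw [blockSum_val_of_le _ _ _ hj]
    have := j.2
    simp
    split_ifs <;> omega

lemma blockSum_one_adjTransposition (n : ℕ) :
    blockSum (1 : Equiv.Perm (Fin n)) (adjTransposition 2 0) = adjTransposition (n + 2) n := by
  ext j
  rw [adjTransposition_val (by omega)]
  rcases Nat.lt_or_ge j n with hj | hj
  · rw [blockSum_val_of_lt _ _ _ hj]
    simp
    split_ifs <;> omega
  · rw [blockSum_val_of_le _ _ _ hj, adjTransposition_val (by omega)]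
    have := j.2
    simp
    split_ifs <;> omega

/-- A permutation which fixes all letters `i < m` lies in every submonoid that contains the
adjacent transpositions of the remaining letters. -/
lemma mem_of_fixing {n m : ℕ} (H : Submonoid (Equiv.Perm (Fin n)))
    (hH : ∀ i, m ≤ i → i + 1 < n → adjTransposition n i ∈ H) (δ : Equiv.Perm (Fin n))
    (hδ : ∀ i : Fin n, (i : ℕ) < m → δ i = i) : δ ∈ H := by
  have key (a : ℕ) (ha : m ≤ a) (d : ℕ) (h : a + (d + 1) < n) :
      Equiv.swap (⟨a, by omega⟩ : Fin n) ⟨a + (d + 1), h⟩ ∈ H := by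
    induction d with
    | zero =>
      have := hH a ha h
      rwa [adjTransposition, dif_pos h] at this
    | succ d ih =>
      have h1 := ih (by omega)
      have h2 := hH (a + (d + 1)) (by omega) (by omega)
      rw [adjTransposition, dif_pos (by omega)] at h2
      have h3 := H.mul_mem (H.mul_mem h2 h1) h2
      rw [Equiv.swap_mul_swap_mul_swap (by simp) (by simp; omega), Equiv.swap_comm] at h3
      exact h3
  have swap_mem (x y : Fin n) (hx : m ≤ (x : ℕ)) (hy : m ≤ (y : ℕ)) : Equiv.swap x y ∈ H := by
    rcases lt_trichotomy x y with h | rfl | h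
    · have := key x hx (y - x - 1) (by omega)
      convert this using 3
      omega
    · rw [Equiv.swap_self]
      exact H.one_mem
    · have := key y hy (x - y - 1) (by omega)
      rw [Equiv.swap_comm]
      convert this using 3
      omega
  let p : Fin n → Prop := fun i ↦ m ≤ (i : ℕ)
  have hp (i : Fin n) : δ i ≠ i → p i := fun h ↦ by
    by_contra h'
    exact h (hδ i (not_le.mp h'))
  have hp' (i : Fin n) : p (δ i) ↔ p i := by
    by_cases h : δ i = i
    · rw [h]
    · refine ⟨fun _ ↦ hp i h, fun _ ↦ hp (δ i) fun h' ↦ h (δ.injective h')⟩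
  have : Equiv.Perm.ofSubtype (δ.subtypePerm hp') = δ :=
    Equiv.Perm.ofSubtype_subtypePerm hp' hp
  rw [← this]
  generalize δ.subtypePerm hp' = ε
  induction ε using Equiv.Perm.swap_induction_on with
  | one => rw [map_one]; exact H.one_mem
  | swap_mul ε x y _ ih =>
    rw [map_mul, Equiv.Perm.ofSubtype_swap_eq]
    exact H.mul_mem (swap_mem _ _ x.2 y.2) ih

/-- The restriction of an injective map to finitely many letters extends to a permutation of `n`
letters for all sufficiently large `n`. -/
lemma exists_perm (f : InjectionMonoid) (m : ℕ) :
    ∃ n₀, ∀ n ≥ n₀, ∃ γ : Equiv.Perm (Fin n), ∀ i : Fin n, (i : ℕ) < m → (γ i : ℕ) = f.1 i := by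
  refine ⟨(Finset.range m).sup f.1 + 1, fun n hn ↦ ?_⟩
  have hlt (i : ℕ) (hi : i < m) : f.1 i < n :=
    (Nat.lt_succ_of_le (Finset.le_sup (f := f.1) (Finset.mem_range.mpr hi))).trans_le hn
  let p : Fin n → Prop := fun i ↦ (i : ℕ) < m
  let g : {i : Fin n // p i} → Fin n := fun i ↦ ⟨f.1 i.1, hlt _ i.2⟩
  have hg : Function.Injective g := fun i j h ↦
    Subtype.ext (Fin.ext (f.2 (congr_arg Fin.val h)))
  classical
  let e : {i : Fin n // p i} ≃ {j : Fin n // j ∈ Set.range g} := Equiv.ofInjective g hg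
  refine ⟨e.extendSubtype, fun i hi ↦ ?_⟩
  exact congr_arg Fin.val (Equiv.extendSubtype_apply_of_mem e i hi)

section stable
variable {G : ℕ → Type*} [∀ n, Group (G n)] {f : ∀ n, G n →* G (n + 1)} {a : ℕ}
  {act : ∀ t, Equiv.Perm (Fin (a + t)) → G t → G t}

/-- Actions of symmetric groups on the groups `G t` which are compatible with the transition maps
and for which the exchange of the last two letters fixes every element that comes from two steps
before. -/
structure IsStableAction (f : ∀ n, G n →* G (n + 1))
    (act : ∀ t, Equiv.Perm (Fin (a + t)) → G t → G t) : Prop where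
  one (t : ℕ) (x : G t) : act t 1 x = x
  mul (t : ℕ) (γ δ : Equiv.Perm (Fin (a + t))) (x : G t) : act t (γ * δ) x = act t γ (act t δ x)
  succ (t : ℕ) (γ : Equiv.Perm (Fin (a + t))) (x : G t) :
    act (t + 1) (blockSum (n := a + t) (p := 1) γ 1) (f t x) = f t (act t γ x)
  swap (t : ℕ) (x : G t) :
    act (t + 2) (blockSum (n := a + t) (p := 2) 1 (adjTransposition 2 0))
      (f (t + 1) (f t x)) = f (t + 1) (f t x)

/-- `γ` extends the restriction of `φ` to the letters `i < m`. -/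
def Extends {n : ℕ} (φ : InjectionMonoid) (m : ℕ) (γ : Equiv.Perm (Fin n)) : Prop :=
  ∀ i : Fin n, (i : ℕ) < m → (γ i : ℕ) = φ.1 i

lemma exists_extends (a : ℕ) (φ : InjectionMonoid) (s : ℕ) :
    ∃ t, ∃ _ : s ≤ t, ∃ γ : Equiv.Perm (Fin (a + t)), Extends φ (a + s) γ := by
  obtain ⟨n, hn⟩ := exists_perm φ (a + s)
  exact ⟨max s n, le_max_left _ _, hn _ (by omega)⟩

lemma IsStableAction.adj (h : IsStableAction f act) (s : ℕ) (x : G s) (t : ℕ) (hst : s ≤ t) (i : ℕ) (hi : a + s ≤ i)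
    (hi' : i + 1 < a + t) :
    act t (adjTransposition (a + t) i) (towerMap f s t hst x) = towerMap f s t hst x := by
  induction t, hst using Nat.le_induction with
  | base => omega
  | succ t hst ih =>
    rw [towerMap_succ_apply _ _ _ hst]
    rcases Nat.lt_or_ge (i + 1) (a + t) with h1 | h1
    · exact (congr_arg (act (t + 1) · _) (blockSum_adjTransposition h1).symm).trans
        ((h.succ t _ _).trans (congr_arg _ (ih h1)))
    · obtain ⟨t, rfl⟩ : ∃ t', t = t' + 1 := ⟨t - 1, by omega⟩
      obtain rfl : i = a + t := by omega
      rw [towerMap_succ_apply _ _ _ (show s ≤ t by omega)]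
      exact (congr_arg (act (t + 2) · _) (blockSum_one_adjTransposition (a + t)).symm).trans
        (h.swap t _)

lemma IsStableAction.fixing (h : IsStableAction f act) (s : ℕ) (x : G s) (t : ℕ) (hst : s ≤ t)
    (δ : Equiv.Perm (Fin (a + t))) (hδ : ∀ i : Fin (a + t), (i : ℕ) < a + s → δ i = i) :
    act t δ (towerMap f s t hst x) = towerMap f s t hst x :=
  mem_of_fixing (m := a + s)
    { carrier := {δ | act t δ (towerMap f s t hst x) = towerMap f s t hst x}
      one_mem' := h.one _ _
      mul_mem' := fun {γ δ} hγ hδ ↦ by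
        change act t (γ * δ) _ = _
        rw [h.mul, show act t δ _ = _ from hδ]
        exact hγ }
    (fun i hi hi' ↦ h.adj s x t hst i hi hi') δ hδ

lemma IsStableAction.congr (h : IsStableAction f act) (s : ℕ) (x : G s) (t : ℕ) (hst : s ≤ t)
    (γ δ : Equiv.Perm (Fin (a + t))) (hγδ : ∀ i : Fin (a + t), (i : ℕ) < a + s → γ i = δ i) :
    act t γ (towerMap f s t hst x) = act t δ (towerMap f s t hst x) := by
  rw [← mul_inv_cancel_left δ γ, h.mul, h.fixing s x t hst]
  intro i hi
  simp [hγδ i hi]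

lemma IsStableAction.raise (h : IsStableAction f act) (t : ℕ) (γ : Equiv.Perm (Fin (a + t))) (t' : ℕ) (ht : t ≤ t') :
    ∃ γ' : Equiv.Perm (Fin (a + t')),
      (∀ i (hi : i < a + t), (γ' ⟨i, by omega⟩ : ℕ) = γ ⟨i, hi⟩) ∧
      ∀ x, act t' γ' (towerMap f t t' ht x) = towerMap f t t' ht (act t γ x) := by
  induction t', ht using Nat.le_induction with
  | base => exact ⟨γ, fun _ _ ↦ rfl, fun x ↦ by simp⟩
  | succ t' ht ih =>
    obtain ⟨γ', h1, h2⟩ := ih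
    refine ⟨blockSum (n := a + t') (p := 1) γ' 1, fun i hi ↦ ?_, fun x ↦ ?_⟩
    · exact (blockSum_val_of_lt (n := a + t') γ' (1 : Equiv.Perm (Fin 1)) ⟨i, by omega⟩
        (show i < a + t' by omega)).trans (h1 i hi)
    · rw [towerMap_succ_apply _ _ _ ht, towerMap_succ_apply _ _ _ ht, ← h2]
      exact h.succ _ _ _

lemma IsStableAction.wellDefined (h : IsStableAction f act) (φ : InjectionMonoid) (s : ℕ) (x : G s) (t t' : ℕ) (ht : s ≤ t)
    (ht' : s ≤ t') (γ : Equiv.Perm (Fin (a + t))) (γ' : Equiv.Perm (Fin (a + t')))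
    (hγ : Extends φ (a + s) γ) (hγ' : Extends φ (a + s) γ') :
    (⟦⟨t, act t γ (towerMap f s t ht x)⟩⟧ : DirectLimit G (towerMap f)) =
      ⟦⟨t', act t' γ' (towerMap f s t' ht' x)⟩⟧ := by
  obtain ⟨δ, h1, h2⟩ := h.raise t γ (max t t') (le_max_left _ _)
  obtain ⟨δ', h1', h2'⟩ := h.raise t' γ' (max t t') (le_max_right _ _)
  refine (DirectLimit.eq_of_le (f := towerMap f) _ (max t t') (le_max_left _ _)).trans
    (Eq.trans ?_ (DirectLimit.eq_of_le (f := towerMap f) _ (max t t') (le_max_right _ _)).symm)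
  dsimp only
  rw [← h2, ← h2', towerMap_towerMap, towerMap_towerMap]
  congr 2
  apply h.congr
  intro i hi
  ext
  exact (h1 i (by omega)).trans ((hγ ⟨i, by omega⟩ hi).trans
    ((hγ' ⟨i, by omega⟩ hi).symm.trans (h1' i (by omega)).symm))

/-- The self-map of the colimit that is induced by an injective map `φ`. The class of `x` is sent
to the class of `γ • x` for any permutation `γ` of sufficiently many letters which agrees with `φ`
on the letters of `x`. -/
def IsStableAction.injMap (h : IsStableAction f act) (φ : InjectionMonoid) :
    DirectLimit G (towerMap f) → DirectLimit G (towerMap f) :=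
  DirectLimit.lift (towerMap f)
    (fun s x ↦ ⟦⟨(exists_extends a φ s).choose,
      act _ (exists_extends a φ s).choose_spec.choose_spec.choose
        (towerMap f s _ (exists_extends a φ s).choose_spec.choose x)⟩⟧) (by
    intro i j hij x
    obtain ⟨t, ht, γ, hγ⟩ := exists_extends a φ j
    rw [h.wellDefined φ j _ _ t _ ht _ γ (exists_extends a φ j).choose_spec.choose_spec.choose_spec
        hγ, h.wellDefined φ i _ _ t _ (hij.trans ht) _ γ
        (exists_extends a φ i).choose_spec.choose_spec.choose_spec
        (fun k hk ↦ hγ k (by omega)), towerMap_towerMap])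

lemma IsStableAction.injMap_mk (h : IsStableAction f act) (φ : InjectionMonoid) (s : ℕ) (x : G s) (t : ℕ) (ht : s ≤ t)
    (γ : Equiv.Perm (Fin (a + t))) (hγ : Extends φ (a + s) γ) :
    h.injMap φ ⟦⟨s, x⟩⟧ = ⟦⟨t, act t γ (towerMap f s t ht x)⟩⟧ :=
  h.wellDefined φ s x _ t _ ht _ γ (exists_extends a φ s).choose_spec.choose_spec.choose_spec hγ

/-- The action of the monoid of injective self-maps of `ℕ` on the colimit. -/
def IsStableAction.injAction (h : IsStableAction f act) : InjectionMonoid →* Function.End (DirectLimit G (towerMap f)) where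
  toFun φ := h.injMap φ
  map_one' := by
    funext x
    induction x using DirectLimit.induction with
    | _ s x =>
      rw [h.injMap_mk 1 s x s le_rfl 1 (fun _ _ ↦ rfl), h.one, towerMap_self]
      rfl
  map_mul' φ ψ := by
    funext x
    induction x using DirectLimit.induction with
    | _ s x =>
      obtain ⟨t, ht, γ, hγ⟩ := exists_extends a ψ s
      obtain ⟨t', ht', δ, hδ⟩ := exists_extends a φ t
      obtain ⟨γ', h1, h2⟩ := h.raise t γ t' ht'
      have hδγ : Extends (φ * ψ) (a + s) (δ * γ') := by
        intro i hi
        have h3 : (γ' i : ℕ) = ψ.1 i := (h1 i (by omega)).trans (hγ ⟨i, by omega⟩ hi)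
        have h4 : (γ' i : ℕ) < a + t := by
          have := h1 i (by omega)
          rw [show γ' i = γ' ⟨i, i.2⟩ from rfl, this]
          exact (γ _).2
        refine (hδ (γ' i) h4).trans ?_
        rw [h3]
        rfl
      change h.injMap (φ * ψ) ⟦⟨s, x⟩⟧ = h.injMap φ (h.injMap ψ ⟦⟨s, x⟩⟧)
      rw [h.injMap_mk ψ s x t ht γ hγ, h.injMap_mk φ t _ t' ht' δ hδ,
        h.injMap_mk (φ * ψ) s x t' (ht.trans ht') (δ * γ') hδγ, h.mul, ← h2, towerMap_towerMap]

end stable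

end

section homotopyGroups
variable {D : Type u} [Category.{v} D] [ModelCategory D] [MonoidalCategory D]
  [SymmetricCategory D] [MonoidalClosed D] [MonoidalModelCategory D]
  {T : D} [IsCofibrant T] [SmashPreservesWeakEquivalences T]
  (c : CogroupStructure ((toHo D).obj T)) (V : D) [IsCofibrant V]

/-- The cogroup structure on `V ∧ T ^ (k + 1)` induced by the one on the first factor `T`. -/
def sphereCogroup : ∀ k, CogroupStructure (sphere T V k)
  | 0 => c.map (hoLeftSmash V)
  | k + 1 => (sphereCogroup k).map (hoSmash T)

set_option linter.unusedVariables false in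
/-- The set `[V ∧ T ^ (k + 1), A]` of morphisms in the homotopy category. It is a group by means
of the cogroup structure `c` on `T`. -/
def HoGroup (c : CogroupStructure ((toHo D).obj T)) (V : D) [IsCofibrant V] (k : ℕ) (A : D) :=
  sphere T V k ⟶ (toHo D).obj A

instance (k : ℕ) (A : D) : Group (HoGroup c V k A) := (sphereCogroup c V k).group _

variable (X : SymmetricSpectrum T)

/-- The group homomorphism `[V ∧ T ^ (k + 1), X m] ⟶ [V ∧ T ^ (k + 2), X (m + 1)]` given by
smashing with `T` and composing with the structure map. -/
def suspend (k m : ℕ) : HoGroup c V k (X.obj m) →* HoGroup c V (k + 1) (X.obj (m + 1)) :=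
  MonoidHom.mk' (suspendHom X k m) fun x y ↦
    (congr_arg (· ≫ _) ((sphereCogroup c V k).map_mul (hoSmash T) x y)).trans
      ((sphereCogroup c V (k + 1)).mul_comp _ _ _)

/-- The least `m ≥ 0` with `q + m ≥ 1`. -/
abbrev startLevel (q : ℤ) : ℕ := (1 - q).toNat

/-- The number `q + m - 1` for the least `m ≥ 0` with `q + m ≥ 1`. -/
abbrev startDim (q : ℤ) : ℕ := (q - 1).toNat

lemma add_startLevel (q : ℤ) (s : ℕ) :
    q + (startLevel q + s : ℕ) = (startDim q + s : ℕ) + 1 := by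
  simp only [startLevel, startDim]
  omega

lemma exists_startLevel_add (q : ℤ) (m : ℕ) (h : 1 ≤ q + m) : ∃ s, m = startLevel q + s :=
  ⟨m - startLevel q, by simp only [startLevel]; omega⟩

/-- The group `[V ∧ T ^ (q + m), X m]` where `m = startLevel q + s`. As `s` runs through the
natural numbers, `m` runs through all natural numbers with `q + m ≥ 1`. -/
abbrev StageGroup (q : ℤ) (s : ℕ) :=
  HoGroup c V (startDim q + s) (X.obj (startLevel q + s))

/-- The transition map `[V ∧ T ^ (q + m), X m] ⟶ [V ∧ T ^ (q + m + 1), X (m + 1)]` where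
`m = startLevel q + s`. -/
def stageMap (q : ℤ) (s : ℕ) : StageGroup c V X q s →* StageGroup c V X q (s + 1) :=
  suspend c V X (startDim q + s) (startLevel q + s)

/-- The stable homotopy group `π_q^V(X)`, the colimit of the groups `[V ∧ T ^ (q + m), X m]` over
all `m ≥ 0` with `q + m ≥ 1`. -/
abbrev HomotopyGroup (q : ℤ) := DirectLimit (StageGroup c V X q) (towerMap (stageMap c V X q))

/-- The canonical map `[V ∧ T ^ (q + m), X m] ⟶ π_q^V(X)` where `m = startLevel q + s`. -/
def ofStage (q : ℤ) (s : ℕ) : StageGroup c V X q s →* HomotopyGroup c V X q :=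
  MonoidHom.mk' (fun x ↦ ⟦⟨s, x⟩⟧) fun x y ↦ (DirectLimit.mul_def s x y).symm

variable {c V X} in
/-- The map `(V ∧ |γ| ∧ T ^ (q + m - 1))^* γ_*` on `[V ∧ T ^ (q + m), X m]` where
`m = startLevel q + s`. -/
def permStage (ε : Sign T) (q : ℤ) (s : ℕ) (γ : Equiv.Perm (Fin (startLevel q + s)))
    (x : StageGroup c V X q s) : StageGroup c V X q s :=
  permHom ε γ x

lemma isStableAction (ε : Sign T) (q : ℤ) :
    IsStableAction (stageMap c V X q) (permStage ε q) where
  one _ x := permHom_one ε x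
  mul _ γ δ x := permHom_mul ε γ δ x
  succ _ γ x := permHom_suspendHom ε γ x
  swap _ x := permHom_swap ε x

/-- The action of the injection monoid on `π_q^V(X)`. -/
def injAction (ε : Sign T) (q : ℤ) :
    InjectionMonoid →* Function.End (HomotopyGroup c V X q) :=
  (isStableAction c V X ε q).injAction

/-- The defining property of the action of the injection monoid: if `x` is an element of
`[V ∧ T ^ (q + m), X m]`, then the action of `φ` maps the class of `x` to the class of the element
of `[V ∧ T ^ (q + n), X n]` that is obtained by stabilizing `x` and applying a permutation of `n`
letters which agrees with `φ` on the first `m` letters. -/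
lemma injAction_ofStage (ε : Sign T) (q : ℤ) (φ : InjectionMonoid) (s t : ℕ) (hst : s ≤ t)
    (γ : Equiv.Perm (Fin (startLevel q + t))) (hγ : Extends φ (startLevel q + s) γ)
    (x : StageGroup c V X q s) :
    injAction c V X ε q φ (ofStage c V X q s x) =
      ofStage c V X q t (permStage ε q t γ (towerMap (stageMap c V X q) s t hst x)) :=
  (isStableAction c V X ε q).injMap_mk φ s x t hst γ hγ

/-- A symmetric spectrum is semistable (with respect to a class `B` of cofibrant objects) if the
injection monoid acts trivially on all its stable homotopy groups. -/
def IsSemistable (ε : Sign T) (B : Set (CofibrantObject D)) : Prop :=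
  ∀ q : ℤ, ∀ V ∈ B, ∀ (φ : InjectionMonoid) (x : HomotopyGroup c V.obj X q),
    injAction c V.obj X ε q φ x = x

end homotopyGroups

end
end SymSp

/-! The injection monoid acts on the colimit, and the class of an element at level `m` is fixed by
every injection `φ` that fixes the first `m` letters (the letters `i < m`, as numbering starts at
`0`): the identity permutation of `m` letters already extends `φ` there. So every class has a finite
filtration. The core of the proof is a statement about an arbitrary set `W` with an action of this
monoid: if one `m` serves for all elements of `W`, the action is trivial
(`action_trivial_of_bounded`).

To see this, let `d` be the shift `i ↦ i + m`. A suitable permutation composed with `d` fixes the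
first `m` letters, hence acts as the identity, so `d` acts injectively. Moreover `d ∘ φ = φ' ∘ d`,
where `φ'` fixes the first `m` letters and is a shifted copy of `φ` on the others. By the bound `φ'`
acts trivially, so `d (φ x) = φ' (d x) = d x`, and injectivity of `d` gives `φ x = x`.

Condition 1 says exactly that all classes come from one level, which supplies the bound. If the
groups stabilize, or if the colimit is finitely generated, a single level again surjects onto the
colimit. In the finitely generated case this holds because the images of the levels form an
increasing chain of subgroups, and one of them contains the finitely many generators.

Condition 2 needs no bound. Every injection agrees on finitely many letters with an even permutation
`γ` of enough letters (`exists_even_extends`). For such `γ` the sign `|γ|` is the identity, and by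
assumption so is the action of `γ` on the spectrum, so the class does not move. -/

namespace SymSp

/-! ### Actions of the monoid of injections on sets, and even extensions of injections. -/

section injectionMonoid
variable {W : Type*} (ρ : InjectionMonoid →* Function.End W)

/-- The injective map `i ↦ i + m`. -/
def shiftInjection (m : ℕ) : InjectionMonoid :=
  ⟨fun i ↦ i + m, add_left_injective m⟩

/-- The injective map which fixes the letters `i < m` and acts as `φ` on the remaining ones. -/
def shiftConj (m : ℕ) (φ : InjectionMonoid) : InjectionMonoid :=
  ⟨fun i ↦ if i < m then i else φ.1 (i - m) + m, fun i j h ↦ by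
    dsimp only at h
    -- The two mixed cases are impossible, since letters below `m` stay below `m` and the others are
    -- sent to values at least `m`.
    split_ifs at h with hi hj hj
    · exact h
    · omega
    · omega
    · have := φ.2 (Nat.add_right_cancel h)
      omega⟩

/-- The exchange of the letters `0, ..., m - 1` with the letters `m, ..., 2 * m - 1`. -/
def blockExchange (m : ℕ) : InjectionMonoid :=
  ⟨fun i ↦ if i < m then i + m else if i < 2 * m then i - m else i, fun i j h ↦ by
    dsimp only at h
    -- The three branches take values in the disjoint sets `[m, 2m)`, `[0, m)` and `[2m, ∞)`, so
    -- only equal branches survive.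
    split_ifs at h <;> omega⟩

/-- The shift takes values in the letters at least `m`, and there `shiftConj m φ` is `φ` transported
along the shift. This relation trades an arbitrary `φ` for an injection that fixes the first `m`
letters. -/
lemma shiftConj_mul_shiftInjection (m : ℕ) (φ : InjectionMonoid) :
    shiftConj m φ * shiftInjection m = shiftInjection m * φ := by
  refine Subtype.ext (funext fun i ↦ ?_)
  change (if i + m < m then i + m else φ.1 (i + m - m) + m) = φ.1 i + m
  rw [if_neg (by omega), Nat.add_sub_cancel]

/-- The shift sends the first block of `m` letters to the second, and the exchange sends it back.
The composite is not the identity on the letters from `m` on, but under a filtration bound `m` it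
acts like the identity, which makes the shift act injectively. -/
lemma blockExchange_mul_shiftInjection_apply {m i : ℕ} (h : i < m) :
    (blockExchange m * shiftInjection m).1 i = i := by
  change (if i + m < m then i + m + m else if i + m < 2 * m then i + m - m else i + m) = i
  rw [if_neg (by omega), if_pos (by omega), Nat.add_sub_cancel]

/-- An action of the injection monoid for which the filtration of the elements is bounded
is trivial. -/
lemma action_trivial_of_bounded (m : ℕ)
    (h : ∀ φ : InjectionMonoid, (∀ i < m, φ.1 i = i) → ∀ x, ρ φ x = x)
    (φ : InjectionMonoid) (x : W) : ρ φ x = x := by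
  have mul_apply (φ ψ : InjectionMonoid) (y : W) : ρ (φ * ψ) y = ρ φ (ρ ψ y) := by
    rw [map_mul]
    rfl
  -- A left inverse of the action of the shift is the action of the block exchange: their composite
  -- fixes the letters below `m`, so `h` applies.
  have hinj : Function.Injective (ρ (shiftInjection m)) := by
    refine Function.LeftInverse.injective (g := ρ (blockExchange m)) fun y ↦ ?_
    rw [← mul_apply]
    exact h _ (fun i hi ↦ blockExchange_mul_shiftInjection_apply hi) y
  -- It suffices to compare after shifting. There `φ` becomes `shiftConj m φ` acting on the shifted
  -- element. Since `h` is applied to `ρ (shiftInjection m) x` and not to `x` itself, the bound has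
  -- to be uniform over `W`.
  apply hinj
  rw [← mul_apply, ← shiftConj_mul_shiftInjection, mul_apply]
  exact h _ (fun i hi ↦ if_pos hi) _

/-- An injective map can be extended, from finitely many letters, to an even permutation. -/
lemma exists_even_extends (a : ℕ) (φ : InjectionMonoid) (s : ℕ) :
    ∃ t, ∃ _ : s ≤ t, ∃ γ : Equiv.Perm (Fin (a + t)),
      Extends φ (a + s) γ ∧ Equiv.Perm.sign γ = 1 := by
  obtain ⟨t, ht, γ, hγ⟩ := exists_extends a φ s
  -- A permutation of two additional letters does not disturb the first `a + t` letters, so the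
  -- extension property survives and the sign can be adjusted freely.
  have key (τ : Equiv.Perm (Fin 2)) : Extends φ (a + s) (blockSum (n := a + t) γ τ) := fun i hi ↦
    (blockSum_val_of_lt γ τ i (by omega)).trans (hγ ⟨i, by omega⟩ hi)
  rcases Int.units_eq_one_or (Equiv.Perm.sign γ) with h | h
  · exact ⟨t, ht, γ, hγ, h⟩
  -- If `γ` is odd, exchanging the two new letters makes the block sum even.
  · exact ⟨t + 2, by omega, blockSum (n := a + t) γ (adjTransposition 2 0), key _,
      (sign_blockSum (n := a + t) γ (adjTransposition 2 0)).trans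
        (by rw [h, sign_adjTransposition]; rfl)⟩

end injectionMonoid

/-! ### Sequences of groups whose transition maps are eventually surjective. -/

section tower
variable {G : ℕ → Type*} [∀ n, Group (G n)] (f : ∀ n, G n →* G (n + 1))

lemma towerMap_surjective (N : ℕ) (hf : ∀ s ≥ N, Function.Surjective (f s)) (n : ℕ) (h : N ≤ n) :
    Function.Surjective (towerMap f N n h) := by
  induction n, h using Nat.le_induction with
  | base => simpa using Function.surjective_id
  | succ n h ih =>
    rw [towerMap_succ f N n h]
    exact (hf n h).comp ih

end tower

/-! ### Stages of the stable homotopy groups and triviality of the action. -/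

section homotopyGroups
variable {D : Type u} [Category.{v} D] [ModelCategory D] [MonoidalCategory D]
  [SymmetricCategory D] [MonoidalClosed D] [MonoidalModelCategory D]
  {T : D} [IsCofibrant T] [SmashPreservesWeakEquivalences T]
  (c : CogroupStructure ((toHo D).obj T)) (V : D) [IsCofibrant V] (X : SymmetricSpectrum T)

lemma ofStage_towerMap (q : ℤ) {s t : ℕ} (h : s ≤ t) (x : StageGroup c V X q s) :
    ofStage c V X q t (towerMap (stageMap c V X q) s t h x) = ofStage c V X q s x :=
  (DirectLimit.eq_of_le (f := towerMap (stageMap c V X q)) ⟨s, x⟩ t h).symm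

lemma exists_ofStage_eq (q : ℤ) (x : HomotopyGroup c V X q) :
    ∃ s y, ofStage c V X q s y = x := by
  induction x using DirectLimit.induction with
  | _ s y => exact ⟨s, y, rfl⟩

/-- An element and its stabilization have the same class. Hence the images of the stages are nested
subgroups, and finitely many classes always lie in a common one. -/
lemma range_ofStage_mono (q : ℤ) : Monotone fun s ↦ (ofStage c V X q s).range := by
  rintro s t h _ ⟨x, rfl⟩
  exact ⟨_, ofStage_towerMap c V X q h x⟩

/-- A class represented at stage `s` is also represented at `max N s`, and from there it can be
lifted back to stage `N` through surjective transition maps. This is the surjective half of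
stabilization; injectivity plays no part. -/
lemma ofStage_surjective_of_stageMap (q : ℤ) (N : ℕ)
    (h : ∀ s ≥ N, Function.Surjective (stageMap c V X q s)) :
    Function.Surjective (ofStage c V X q N) := by
  intro x
  obtain ⟨s, y, rfl⟩ := exists_ofStage_eq c V X q x
  obtain ⟨z, hz⟩ := towerMap_surjective _ N h (max N s) (le_max_left _ _)
    (towerMap (stageMap c V X q) s _ (le_max_right _ _) y)
  exact ⟨z, by rw [← ofStage_towerMap c V X q (le_max_left N s), hz, ofStage_towerMap]⟩

/-- If a stable homotopy group is finitely generated, then its generators, and hence all of its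
elements, come from a single stage. -/
lemma exists_ofStage_surjective_of_fg (q : ℤ) (h : Group.FG (HomotopyGroup c V X q)) :
    ∃ s, Function.Surjective (ofStage c V X q s) := by
  obtain ⟨S, hS⟩ := Group.fg_def.mp h
  have hb : ∃ s, ∀ x ∈ S, x ∈ (ofStage c V X q s).range := by
    -- The claim holds for any finite set of classes. The generation hypothesis would not pass to
    -- the smaller sets of the induction.
    clear hS
    classical
    induction S using Finset.induction_on with
    | empty => exact ⟨0, by simp⟩
    | insert x S _ ih =>
      obtain ⟨s, hs⟩ := ih
      obtain ⟨t, y, hy⟩ := exists_ofStage_eq c V X q x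
      refine ⟨max s t, fun z hz ↦ ?_⟩
      rcases Finset.mem_insert.mp hz with rfl | hz
      · exact range_ofStage_mono c V X q (le_max_right s t) ⟨y, hy⟩
      · exact range_ofStage_mono c V X q (le_max_left s t) (hs z hz)
  obtain ⟨s, hs⟩ := hb
  -- The range of the homomorphism `ofStage` is a subgroup, so containing the generators forces it
  -- to be everything.
  refine ⟨s, MonoidHom.range_eq_top.mp (top_unique ?_)⟩
  rw [← hS, Subgroup.closure_le]
  exact hs

/-- On the letters of the level of `x`, the injection `φ` agrees with the identity permutation. So
no stabilization is needed, and the identity can be used to compute the action. -/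
lemma injAction_ofStage_of_fixes (ε : Sign T) (q : ℤ) (s : ℕ) (φ : InjectionMonoid)
    (hφ : ∀ i < startLevel q + s, φ.1 i = i) (x : StageGroup c V X q s) :
    injAction c V X ε q φ (ofStage c V X q s x) = ofStage c V X q s x := by
  rw [injAction_ofStage c V X ε q φ s s le_rfl 1 (fun i hi ↦ (hφ i hi).symm), towerMap_self]
  exact congr_arg _ (permHom_one ε x)

/-- Surjectivity of one stage bounds the filtration of all classes by its level `startLevel q + s`,
which is the input for `action_trivial_of_bounded`. -/
lemma injAction_trivial_of_ofStage_surjective (ε : Sign T) (q : ℤ) (s : ℕ)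
    (h : Function.Surjective (ofStage c V X q s)) (φ : InjectionMonoid)
    (x : HomotopyGroup c V X q) : injAction c V X ε q φ x = x := by
  refine action_trivial_of_bounded _ (startLevel q + s) (fun ψ hψ y ↦ ?_) φ x
  obtain ⟨y, rfl⟩ := h y
  exact injAction_ofStage_of_fixes c V X ε q s ψ hψ y

/-- The permutation enters twice, through the sign on the sphere and through the action on the level
of the spectrum. Evenness removes the first, and `h` removes the second. -/
lemma permStage_of_sign_eq_one (ε : Sign T) (q : ℤ) (s : ℕ)
    (γ : Equiv.Perm (Fin (startLevel q + s))) (hγ : Equiv.Perm.sign γ = 1)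
    (h : (toHo D).map (X.act _ γ) = 𝟙 ((toHo D).obj (X.obj (startLevel q + s))))
    (x : StageGroup c V X q s) : permStage ε q s γ x = x := by
  change (sphereFunctor T V _).map (signMap ε.neg γ) ≫ x ≫ (toHo D).map (X.act _ γ) = x
  rw [signMap, if_pos hγ, CategoryTheory.Functor.map_id, h, Category.id_comp]
  exact Category.comp_id _

/-- Any permutation extending `φ` computes the action, so an even one may be chosen. It acts as the
identity on the stabilized representative, whose class is the original one. -/
lemma injAction_trivial_of_even (ε : Sign T) (q : ℤ)
    (h : ∀ (l : ℕ) (γ : Equiv.Perm (Fin l)), Equiv.Perm.sign γ = 1 →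
      (toHo D).map (X.act l γ) = 𝟙 ((toHo D).obj (X.obj l)))
    (φ : InjectionMonoid) (x : HomotopyGroup c V X q) : injAction c V X ε q φ x = x := by
  obtain ⟨s, y, rfl⟩ := exists_ofStage_eq c V X q x
  obtain ⟨t, hst, γ, hγ, hsign⟩ := exists_even_extends (startLevel q) φ s
  rw [injAction_ofStage c V X ε q φ s t hst γ hγ,
    permStage_of_sign_eq_one c V X ε q t γ hsign (h _ γ hsign), ofStage_towerMap]

end homotopyGroups

end SymSp

/-- The four conjuncts are condition 1, the supplement on stabilization, condition 2 and condition
3. Stage `s` stands for the level `startLevel q + s`, and these are exactly the levels `l ≥ 0` with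
`q + l ≥ 1`, so quantifying over `s` encodes the side condition on `l`. Condition 3 asks for finite
generation as a group only, which covers finitely generated abelian groups. The zero object
expresses that the model category is pointed. -/
theorem proposition2p25 {D : Type u} [Category.{v} D] [ModelCategory D] [HasZeroObject D]
    [MonoidalCategory D] [SymmetricCategory D] [MonoidalClosed D] [SymSp.MonoidalModelCategory D]
    (T : D) [IsCofibrant T] [SymSp.SmashPreservesWeakEquivalences T]
    (c : SymSp.CogroupStructure ((SymSp.toHo D).obj T)) (ε : SymSp.Sign T)
    (B : Set (CofibrantObject D)) (X : SymSp.SymmetricSpectrum T) :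
    ((∀ q : ℤ, ∀ V ∈ B, ∃ s : ℕ, Function.Surjective (SymSp.ofStage c V.obj X q s)) →
      SymSp.IsSemistable c X ε B) ∧
    ((∀ q : ℤ, ∀ V ∈ B, ∃ N : ℕ, ∀ s ≥ N, Function.Bijective (SymSp.stageMap c V.obj X q s)) →
      ∀ q : ℤ, ∀ V ∈ B, ∃ s : ℕ, Function.Surjective (SymSp.ofStage c V.obj X q s)) ∧
    ((∀ (l : ℕ) (γ : Equiv.Perm (Fin l)), Equiv.Perm.sign γ = 1 →
        (SymSp.toHo D).map (X.act l γ) = 𝟙 ((SymSp.toHo D).obj (X.obj l))) →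
      SymSp.IsSemistable c X ε B) ∧
    ((∀ q : ℤ, ∀ V ∈ B, Group.FG (SymSp.HomotopyGroup c V.obj X q)) →
      SymSp.IsSemistable c X ε B) := by
  refine ⟨fun h q V hV φ x ↦ ?_, fun h q V hV ↦ ?_, fun h q V _ φ x ↦ ?_, fun h q V hV φ x ↦ ?_⟩
  · obtain ⟨s, hs⟩ := h q V hV
    exact SymSp.injAction_trivial_of_ofStage_surjective c V.obj X ε q s hs φ x
  · obtain ⟨N, hN⟩ := h q V hV
    exact ⟨N, SymSp.ofStage_surjective_of_stageMap c V.obj X q N fun s hs ↦ (hN s hs).2⟩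
  · exact SymSp.injAction_trivial_of_even c V.obj X ε q h φ x
  · obtain ⟨s, hs⟩ := SymSp.exists_ofStage_surjective_of_fg c V.obj X q (h q V hV)
    exact SymSp.injAction_trivial_of_ofStage_surjective c V.obj X ε q s hs φ x
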